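/- A discrete quantum group $\mathbb G=(\ell^\infty(\mathbb G),\Delta,\varphi,\psi)$ consists of a nonzero $\ell^\infty$-direct sum of full matrix algebras $\ell^\infty(\mathbb G)=\bigoplus_{i\in I}M_{n_i}(\mathbb C)$ with $n_i\ge 1$, a normal unital $*$-homomorphism $\Delta:\ell^\infty(\mathbb G)\to\ell^\infty(\mathbb G)\,\overline\otimes\,\ell^\infty(\mathbb G)$ with $(\Delta\otimes\mathrm{id})\Delta=(\mathrm{id}\otimes\Delta)\Delta$, and normal semi-finite faithful weights $\varphi,\psi$ on $\ell^\infty(\mathbb G)$ such that, for every positive normal functional $\omega$ on $\ell^\infty(\mathbb G)$, $\varphi((\omega\otimes\mathrm{id})\Delta(x))=\omega(1)\varphi(x)$ for all $x\ge0$ with $\varphi(x)<\infty$, and $\psi((\mathrm{id}\otimes\omega)\Delta(x))=\omega(1)\psi(x)$ for all $x\ge 0$ with $\psi(x)<\infty$. An action of $\mathbb G$ on a von Neumann algebra $N$ is an injective normal unital $*$-homomorphism $\alpha:N\to\ell^\infty(\mathbb G)\,\overline\otimes\,N$ with $(\Delta\otimes\mathrm{id})\alpha=(\mathrm{id}\otimes\alpha)\alpha$.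 It is called amenable if there is a conditional expectation $E$ from $\ell^\infty(\mathbb G)\,\overline\otimes\,N$ onto $\alpha(N)$ with $(\mathrm{id}\otimes E)(\Delta\otimes\mathrm{id})=(\Delta\otimes\mathrm{id})E$ on $\ell^\infty(\mathbb G)\,\overline\otimes\,N$. **Proposition.** Every discrete quantum group acts amenably on itself. That is, for every discrete quantum group $\mathbb G$, the co-multiplication $\Delta$ is an action of $\mathbb G$ on $N=\ell^\infty(\mathbb G)$, and this action is amenable. More precisely, $\mathbb G$ has a co-unit, i.e. a normal unital $*$-homomorphism $\varepsilon:\ell^\infty(\mathbb G)\to\mathbb C$ with $(\varepsilon\otimes\mathrm{id})\Delta=\mathrm{id}=(\mathrm{id}\otimes\varepsilon)\Delta$, and for any such $\varepsilon$ the map $E_\Delta=\Delta\circ(\mathrm{id}\otimes\varepsilon)$ is a conditional expectation from $\ell^\infty(\mathbb G)\,\overline\otimes\,\ell^\infty(\mathbb G)$ onto $\Delta(\ell^\infty(\mathbb G))$ with $(\mathrm{id}\otimes E_\Delta)(\Delta\otimes\mathrm{id})=(\Delta\otimes\mathrm{id})E_\Delta$. -/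

import Mathlib

open scoped ENNReal NNReal ComplexOrder

universe u v w

namespace DQG

noncomputable section

/-! ### Block sums of matrix algebras

For a von Neumann algebra `N` and a family of natural numbers `n i`, the von Neumann algebra
`(⨁ᵢ M_{n i}(ℂ)) ⊗̄ N` is the `ℓ^∞`-direct sum `⨁ᵢ M_{n i}(N)`, i.e. the algebra of all families
`x i ∈ M_{n i}(N)` with `supᵢ ‖x i‖ < ∞`, where `M_{n i}(N)` carries its C⋆-norm. -/

/-- `(⨁ᵢ M_{n i}(ℂ)) ⊗̄ N`: all bounded families `x i ∈ M_{n i}(N)`. For `N = ℂ` this is the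
`ℓ^∞`-direct sum of the matrix algebras `M_{n i}(ℂ)`.
The entry of the block `x i` at `(a, b)` is `x i a b : N`; it is the slice of `x` by the `(a, b)`
matrix coefficient of the `i`-th block in the first tensor leg. -/
def BlockSum {ι : Type u} (n : ι → ℕ) (N : Type v) [CStarAlgebra N] [PartialOrder N]
    [StarOrderedRing N] : Type (max u v) :=
  lp (fun i => CStarMatrix (Fin (n i)) (Fin (n i)) N) ∞

section BlockSum

variable {ι : Type u} (n : ι → ℕ) (N : Type v) [CStarAlgebra N] [PartialOrder N]
  [StarOrderedRing N]

/-- The blocks of a family. -/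
instance instCoeFunBlockSum :
    CoeFun (BlockSum n N) fun _ => ∀ i, CStarMatrix (Fin (n i)) (Fin (n i)) N :=
  ⟨fun x => x.1⟩

instance instNonUnitalCStarAlgebraBlockSum : NonUnitalCStarAlgebra (BlockSum n N) :=
  inferInstanceAs
    (NonUnitalCStarAlgebra (lp (fun i => CStarMatrix (Fin (n i)) (Fin (n i)) N) ∞))

instance instNormedRingBlockSum [∀ i, NeZero (n i)] [Nontrivial N] : NormedRing (BlockSum n N) :=
  inferInstanceAs (NormedRing (lp (fun i => CStarMatrix (Fin (n i)) (Fin (n i)) N) ∞))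

instance instNormedAlgebraBlockSum [∀ i, NeZero (n i)] [Nontrivial N] :
    NormedAlgebra ℂ (BlockSum n N) :=
  inferInstanceAs (NormedAlgebra ℂ (lp (fun i => CStarMatrix (Fin (n i)) (Fin (n i)) N) ∞))

/-- The C⋆-algebra structure, with blockwise operations and the supremum norm. -/
instance instCStarAlgebraBlockSum [∀ i, NeZero (n i)] [Nontrivial N] :
    CStarAlgebra (BlockSum n N) where

/-- The usual order of a C⋆-algebra: `x ≤ y` iff `y - x` is positive. -/
instance instPartialOrderBlockSum : PartialOrder (BlockSum n N) :=
  CStarAlgebra.spectralOrder _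

instance instStarOrderedRingBlockSum : StarOrderedRing (BlockSum n N) :=
  CStarAlgebra.spectralOrderedRing _

instance instNontrivialBlockSum [∀ i, NeZero (n i)] [Nontrivial N] [Nonempty ι] :
    Nontrivial (BlockSum n N) :=
  NormOneClass.nontrivial (G := lp (fun i => CStarMatrix (Fin (n i)) (Fin (n i)) N) ∞)

end BlockSum

/-! ### Normal maps and weights -/

/-- A (positive) map between von Neumann algebras is normal if it preserves suprema of bounded
upward directed sets of self-adjoint elements. -/
def IsNormalMap {M : Type v} {M' : Type w} [CStarAlgebra M] [PartialOrder M]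
    [PartialOrder M'] (Φ : M → M') : Prop :=
  ∀ D : Set M, D.Nonempty → DirectedOn (· ≤ ·) D → (∀ d ∈ D, IsSelfAdjoint d) →
    ∀ a : M, IsLUB D a → IsLUB (Φ '' D) (Φ a)

/-- Positive normal functionals: the positive elements of the predual. -/
def IsPositiveNormal {M : Type v} [CStarAlgebra M] [PartialOrder M] (ω : M →L[ℂ] ℂ) : Prop :=
  (∀ x, 0 ≤ x → 0 ≤ ω x) ∧ IsNormalMap ω

/-- A normal semi-finite faithful weight `φ : M₊ → [0, ∞]`. Only the values of `toFun` at positive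
elements are meaningful (and constrained, or used anywhere). -/
structure NSFWeight (M : Type v) [CStarAlgebra M] [PartialOrder M] where
  toFun : M → ℝ≥0∞
  map_add : ∀ x y, 0 ≤ x → 0 ≤ y → toFun (x + y) = toFun x + toFun y
  map_smul : ∀ (c : ℝ≥0) (x : M), 0 ≤ x → toFun (((c : ℝ) : ℂ) • x) = c * toFun x
  normal : ∀ D : Set M, D.Nonempty → DirectedOn (· ≤ ·) D → (∀ d ∈ D, 0 ≤ d) →
    ∀ a : M, IsLUB D a → IsLUB (toFun '' D) (toFun a)
  faithful : ∀ x, 0 ≤ x → toFun x = 0 → x = 0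
  /-- the positive elements of finite weight contain a net increasing to `1` -/
  semifinite : ∃ D : Set M, D.Nonempty ∧ DirectedOn (· ≤ ·) D ∧
    (∀ d ∈ D, 0 ≤ d ∧ toFun d < ∞) ∧ IsLUB D 1

/-! ### Slice maps -/

section Slices

variable {ι : Type u} {n : ι → ℕ} {N : Type v} [CStarAlgebra N] [PartialOrder N]
  [StarOrderedRing N]

open Classical in
/-- The matrix unit `e_{ab}` of the `i`-th block of `⨁ᵢ M_{n i}(ℂ)`. -/
def matUnit (n : ι → ℕ) (i : ι) (a b : Fin (n i)) : BlockSum n ℂ :=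
  lp.single ∞ i (CStarMatrix.ofMatrix (Matrix.single a b (1 : ℂ)))

/-- The slice map `ω ⊗ id : (⨁ᵢ M_{n i}(ℂ)) ⊗̄ N → N` for a normal functional `ω` on
`⨁ᵢ M_{n i}(ℂ)`. As `x = ∑ᵢ ∑_{ab} e^i_{ab} ⊗ x i a b`, its value is
`∑ᵢ ∑_{ab} ω(e^i_{ab}) x i a b`; for normal `ω` the series converges absolutely in norm. -/
def leftSlice (ω : BlockSum n ℂ → ℂ) (x : BlockSum n N) : N :=
  ∑' i, ∑ a, ∑ b, ω (matUnit n i a b) • x i a b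

open WithCStarModule in
/-- Auxiliary norm bound. -/
theorem norm_lift_le {k : ℕ} (v : C⋆ᵐᵒᵈ(ℂ, Fin k → ℂ)) :
    ‖((equiv N (Fin k → N)).symm fun i => v i • (1 : N))‖ ≤ ‖v‖ := by
  rw [pi_norm, pi_norm]
  apply Real.sqrt_le_sqrt
  simp only [inner_def, equiv_symm_pi_apply, star_smul, star_one, smul_mul_smul_comm, mul_one]
  rw [← Finset.sum_smul, norm_smul]
  have : ‖(1 : N)‖ ≤ 1 := by
    rcases subsingleton_or_nontrivial N with h | h
    · rw [Subsingleton.elim (1 : N) 0]; simp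
    · simp
  exact mul_le_of_le_one_right (norm_nonneg _) this

open WithCStarModule in
/-- Bounded functionals are completely bounded, with the same bound. -/
theorem norm_map_functional_le {k : ℕ} (ω : N →L[ℂ] ℂ)
    (X : CStarMatrix (Fin k) (Fin k) N) : ‖X.map ω‖ ≤ ‖ω‖ * ‖X‖ := by
  have key : ‖X.map ω‖ ≤ ((‖ω‖₊ * ‖X‖₊ : ℝ≥0) : ℝ) := by
    refine CStarMatrix.norm_le_of_forall_inner_le fun v w => ?_
    let v' : C⋆ᵐᵒᵈ(N, Fin k → N) := (equiv N (Fin k → N)).symm fun i => v i • (1 : N)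
    let w' : C⋆ᵐᵒᵈ(N, Fin k → N) := (equiv N (Fin k → N)).symm fun i => w i • (1 : N)
    have h : inner ℂ w (CStarMatrix.toCLM (X.map ω) v) =
        ω (inner N w' (CStarMatrix.toCLM X v')) := by
      simp only [pi_inner, CStarMatrix.toCLM_apply_eq_sum, inner_def, equiv_symm_pi_apply, v', w',
        CStarMatrix.map_apply, map_sum, Finset.sum_mul, star_smul, star_one, smul_mul_assoc,
        one_mul, mul_smul_comm, mul_one, map_smul, smul_eq_mul]
      refine Finset.sum_congr rfl fun i _ => ?_
      rw [Finset.mul_sum]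
      exact Finset.sum_congr rfl fun j _ => mul_comm _ _
    rw [h]
    calc ‖ω (inner N w' (CStarMatrix.toCLM X v'))‖
        ≤ ‖ω‖ * ‖inner N w' (CStarMatrix.toCLM X v')‖ := ω.le_opNorm _
      _ ≤ ‖ω‖ * (‖w'‖ * (‖X‖ * ‖v'‖)) := by
          gcongr
          refine (CStarModule.norm_inner_le _).trans ?_
          gcongr
          exact (CStarMatrix.toCLM X).le_opNorm v'
      _ ≤ ‖ω‖ * (‖w‖ * (‖X‖ * ‖v‖)) := by
          gcongr
          · exact norm_lift_le w
          · exact norm_lift_le v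
      _ = _ := by rw [NNReal.coe_mul, coe_nnnorm, coe_nnnorm]; ring
  simpa using key

theorem memlp_map_functional (ω : N →L[ℂ] ℂ) (x : BlockSum n N) :
    Memℓp (fun i => (x i).map ω) ∞ := by
  refine memℓp_infty ⟨‖ω‖ * ‖x‖, ?_⟩
  rintro _ ⟨i, rfl⟩
  exact (norm_map_functional_le ω (x i)).trans
    (mul_le_mul_of_nonneg_left (lp.norm_apply_le_norm ENNReal.top_ne_zero x i) (norm_nonneg _))

/-- The slice map `id ⊗ ω : (⨁ᵢ M_{n i}(ℂ)) ⊗̄ N → ⨁ᵢ M_{n i}(ℂ)` for a functional `ω` on `N`: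
`ω` is applied to all entries of all blocks. -/
def rightSlice (ω : N →L[ℂ] ℂ) : BlockSum n N →ₗ[ℂ] BlockSum n ℂ where
  toFun x := ⟨fun i => (x i).map ω, memlp_map_functional ω x⟩
  map_add' x y := by
    refine Subtype.ext (funext fun i => CStarMatrix.ext fun a b => ?_)
    exact map_add ω (x i a b) (y i a b)
  map_smul' c x := by
    refine Subtype.ext (funext fun i => CStarMatrix.ext fun a b => ?_)
    exact map_smul ω c (x i a b)

variable [∀ i, NeZero (n i)] [Nonempty ι]

/-- The entries of `(Δ ⊗ id)(x)` for `x ∈ ℓ^∞ ⊗̄ N`, where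
`Δ : ℓ^∞ → ℓ^∞ ⊗̄ ℓ^∞` is normal and `ℓ^∞ = ⨁ᵢ M_{n i}(ℂ)`: the entry of
`(Δ ⊗ id)(x) ∈ ℓ^∞ ⊗̄ ℓ^∞ ⊗̄ N` at `(i, a, b)` in the first leg and `(j, c, d)` in the second leg
is the slice of `x` by the normal functional `m ↦ Δ(m) i a b j c d`. -/
def comulTensorIdEntry (Δ : BlockSum n ℂ →⋆ₐ[ℂ] BlockSum n (BlockSum n ℂ)) (x : BlockSum n N)
    (i : ι) (a b : Fin (n i)) (j : ι) (c d : Fin (n j)) : N :=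
  leftSlice (fun m => Δ m i a b j c d) x

end Slices

end

/-! ### Discrete quantum groups -/

/-- A discrete quantum group `𝔾 = (ℓ^∞(𝔾), Δ, φ, ψ)`: a (nonzero) `ℓ^∞`-direct sum
`ℓ^∞(𝔾) = ⨁ᵢ M_{dim i}(ℂ)` of matrix algebras, a co-associative co-multiplication `Δ`
(a normal unital ⋆-homomorphism), and normal semi-finite faithful left, respectively right,
invariant weights `φ` and `ψ`. -/
structure DiscreteQuantumGroup where
  ι : Type u
  [nonempty : Nonempty ι]
  dim : ι → ℕ
  [dim_ne_zero : ∀ i, NeZero (dim i)]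
  comul : BlockSum dim ℂ →⋆ₐ[ℂ] BlockSum dim (BlockSum dim ℂ)
  comul_normal : IsNormalMap comul
  /-- `(Δ ⊗ id) Δ = (id ⊗ Δ) Δ`, entry by entry -/
  coassoc : ∀ (x : BlockSum dim ℂ) (i : ι) (a b : Fin (dim i)) (j : ι) (c d : Fin (dim j)),
    comulTensorIdEntry comul (comul x) i a b j c d = comul (comul x i a b) j c d
  leftHaar : NSFWeight (BlockSum dim ℂ)
  /-- `φ((ω ⊗ id)Δ(x)) = ω(1) φ(x)` for `x ∈ M_φ⁺` and `ω ∈ ℓ¹(𝔾)₊` -/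
  left_invariant : ∀ ω : BlockSum dim ℂ →L[ℂ] ℂ, IsPositiveNormal ω → ∀ x, 0 ≤ x →
    leftHaar.toFun x < ∞ →
      leftHaar.toFun (leftSlice ω (comul x)) = ENNReal.ofReal (ω 1).re * leftHaar.toFun x
  rightHaar : NSFWeight (BlockSum dim ℂ)
  /-- `ψ((id ⊗ ω)Δ(x)) = ω(1) ψ(x)` for `x ∈ M_ψ⁺` and `ω ∈ ℓ¹(𝔾)₊` -/
  right_invariant : ∀ ω : BlockSum dim ℂ →L[ℂ] ℂ, IsPositiveNormal ω → ∀ x, 0 ≤ x →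
    rightHaar.toFun x < ∞ →
      rightHaar.toFun (rightSlice ω (comul x)) = ENNReal.ofReal (ω 1).re * rightHaar.toFun x

namespace DiscreteQuantumGroup

attribute [instance] DiscreteQuantumGroup.nonempty DiscreteQuantumGroup.dim_ne_zero

variable (G : DiscreteQuantumGroup.{u})

/-- `ℓ^∞(𝔾)`. -/
abbrev EllInf : Type u := BlockSum G.dim ℂ

/-- `ℓ^∞(𝔾) ⊗̄ N`. -/
abbrev Tensor (N : Type v) [CStarAlgebra N] [PartialOrder N] [StarOrderedRing N] : Type (max u v) :=
  BlockSum G.dim N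

section Actions

variable {N : Type v} [CStarAlgebra N] [PartialOrder N] [StarOrderedRing N] [Nontrivial N]

/-- `α : N → ℓ^∞(𝔾) ⊗̄ N` is a (left) action of `𝔾` on the von Neumann algebra `N`: an injective
normal unital ⋆-homomorphism with `(Δ ⊗ id) α = (id ⊗ α) α`. -/
structure IsAction (α : N →⋆ₐ[ℂ] G.Tensor N) : Prop where
  injective : Function.Injective α
  normal : IsNormalMap α
  coaction : ∀ (x : N) (i : G.ι) (a b : Fin (G.dim i)) (j : G.ι) (c d : Fin (G.dim j)),
    comulTensorIdEntry G.comul (α x) i a b j c d = α (α x i a b) j c d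

/-- `E` is a conditional expectation from `ℓ^∞(𝔾) ⊗̄ N` onto `α(N)`. -/
structure IsConditionalExpectation (α : N →⋆ₐ[ℂ] G.Tensor N)
    (E : G.Tensor N →ₗ[ℂ] G.Tensor N) : Prop where
  mem_range : ∀ x, E x ∈ Set.range α
  apply_range : ∀ y, E (α y) = α y
  positive : ∀ x, 0 ≤ x → 0 ≤ E x
  contractive : ∀ x, ‖E x‖ ≤ ‖x‖
  bimodule : ∀ y x z, E (α y * x * α z) = α y * E x * α z

/-- The equivariance `(id ⊗ E)(Δ ⊗ id) = (Δ ⊗ id) E` of a linear map `E` on `ℓ^∞(𝔾) ⊗̄ N`.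
For each `x`, the element `y ∈ ℓ^∞(𝔾) ⊗̄ (ℓ^∞(𝔾) ⊗̄ N)` is `(Δ ⊗ id)(x)` (it is determined by its
entries), and `id ⊗ E` applies `E` to the entries `y i a b ∈ ℓ^∞(𝔾) ⊗̄ N` of `y` with respect to the
first leg. -/
def IsEquivariant (E : G.Tensor N →ₗ[ℂ] G.Tensor N) : Prop :=
  ∀ x : G.Tensor N, ∃ y : G.Tensor (G.Tensor N),
    (∀ (i : G.ι) (a b : Fin (G.dim i)) (j : G.ι) (c d : Fin (G.dim j)),
      y i a b j c d = comulTensorIdEntry G.comul x i a b j c d) ∧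
    (∀ (i : G.ι) (a b : Fin (G.dim i)) (j : G.ι) (c d : Fin (G.dim j)),
      E (y i a b) j c d = comulTensorIdEntry G.comul (E x) i a b j c d)

/-- An action `α` of `𝔾` on `N` is amenable if there is a conditional expectation
`E : ℓ^∞(𝔾) ⊗̄ N → α(N)` with `(id ⊗ E)(Δ ⊗ id) = (Δ ⊗ id) E`. -/
def IsAmenable (α : N →⋆ₐ[ℂ] G.Tensor N) : Prop :=
  ∃ E : G.Tensor N →ₗ[ℂ] G.Tensor N, G.IsConditionalExpectation α E ∧ G.IsEquivariant E

end Actions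

/-- `ε` is the co-unit of `𝔾`: a normal unital ⋆-homomorphism `ε : ℓ^∞(𝔾) → ℂ` with
`(ε ⊗ id) Δ = id = (id ⊗ ε) Δ`. -/
structure IsCounit (ε : G.EllInf →L[ℂ] ℂ) : Prop where
  map_one : ε 1 = 1
  map_mul : ∀ x y, ε (x * y) = ε x * ε y
  map_star : ∀ x, ε (star x) = star (ε x)
  normal : IsNormalMap ε
  left_counit : ∀ x, leftSlice ε (G.comul x) = x
  right_counit : ∀ x, rightSlice ε (G.comul x) = x

end DiscreteQuantumGroup

end DQG

/-!
The difficulty lies in the co-unit, which is not part of the data: it has to be extracted from the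
invariant weights. Let `B` be the space of functionals on `ℓ^∞(𝔾) = ⨁ᵢ M_{n i}(ℂ)` which only
depend on finitely many blocks, with its convolution product `ω * η = (ω ⊗ η)Δ`. A co-unit is a
unit of `B` which is a ⋆-character.

*From invariance to solvability of convolution equations.* A normal semi-finite weight is a sum of
finite positive functionals on the blocks (`NSFWeight.eq_tsum`, `NSFWeight.exists_linearMap`), so
that invariance can be polarized. If `u^i` is the matrix of coefficients of the `i`-th block, left
invariance and faithfulness of `φ` then say that `e_a ⊗ y ↦ ∑_c e_c ⊗ Δ(y)_{i;ca}` is isometric for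
the inner product of `φ` (`NSFWeight.eq_zero_of_invariant`). By duality, which is a matter of finite
dimensional linear algebra as all maps respect the decomposition into blocks, every system
`w_a = ∑_b u^i_{ab} * v_b` is solvable in `B` (`exists_left_convolution_eq`); right invariance gives
solutions of `w_b = ∑_a v_a * u^j_{ab}` (`exists_right_convolution_eq`).

*From solvability to a unit.* This is the argument by which a semigroup in which all left and right
translations are surjective has a unit. If `u e = u` for a matrix `e` over `B`, then every row
`w = v u` satisfies `w e = v u e = v u = w`, so that a diagonal entry of `e` is a right unit
(`exists_right_unit`); a left unit is obtained in the same way, and both agree. Only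
co-associativity enters here, in the form `slice_comul_entry`. Its use requires that each
`(π_i ⊗ π_j)Δ` factors through finitely many blocks (`exists_support_comulEntry`): only finitely
many of the orthogonal idempotents `(π_i ⊗ π_j)Δ(p_k)` of a matrix algebra are nonzero, and `Δ` is
normal.

*The unit is a character.* It is self-adjoint by uniqueness, and it is multiplicative because
solvability also shows that `Δ_B(ε)` is a unit of `B ⊗ B`, where `Δ_B` is dual to the multiplication
of `ℓ^∞(𝔾)` (`unit_map_slice_mul_slice`).

For any co-unit `ε` the slice map `id ⊗ ε` is a ⋆-homomorphism, and the properties of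
`E = Δ ∘ (id ⊗ ε)` follow from the co-unit identities and co-associativity. That `(Δ ⊗ id)(x)` is a
bounded family holds because its components are values of ⋆-homomorphisms between C⋆-algebras,
which are contractive (`norm_comulTensorIdBlock_le`, `norm_comulTensorIdSlice_le`).
-/

namespace DQG

noncomputable section

/-! ### Blocks and entries of block sums -/

theorem mul_nonneg_of_central_idempotent {A : Type*} [CStarAlgebra A] [PartialOrder A]
    [StarOrderedRing A] {p x : A} (hs : star p = p) (hi : p * p = p) (hc : p * x = x * p)
    (hx : 0 ≤ x) : 0 ≤ p * x := by
  rw [← hi, mul_assoc, hc, ← mul_assoc]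
  nth_rw 1 [← hs]
  exact star_left_conjugate_nonneg hx _

section Entries

variable {ι : Type u} {n : ι → ℕ} {N : Type v} [CStarAlgebra N] [PartialOrder N]
  [StarOrderedRing N]

namespace BlockSum

theorem ext {x y : BlockSum n N} (h : ∀ i, x i = y i) : x = y :=
  Subtype.ext (funext h)

theorem ext_entry {x y : BlockSum n N} (h : ∀ i a b, x i a b = y i a b) : x = y :=
  ext fun i => CStarMatrix.ext (h i)

@[simp] theorem add_block (x y : BlockSum n N) (i : ι) : (x + y) i = x i + y i := rfl
@[simp] theorem sub_block (x y : BlockSum n N) (i : ι) : (x - y) i = x i - y i := rfl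
@[simp] theorem zero_block (i : ι) : (0 : BlockSum n N) i = 0 := rfl
@[simp] theorem smul_block (c : ℂ) (x : BlockSum n N) (i : ι) : (c • x) i = c • x i := rfl
@[simp] theorem mul_block (x y : BlockSum n N) (i : ι) : (x * y) i = x i * y i := rfl
@[simp] theorem star_block (x : BlockSum n N) (i : ι) : (star x) i = star (x i) := rfl

theorem mul_entry (x y : BlockSum n N) (i : ι) (a b : Fin (n i)) :
    (x * y) i a b = ∑ c, x i a c * y i c b := by
  rw [mul_block, CStarMatrix.mul_apply]

theorem star_entry (x : BlockSum n N) (i : ι) (a b : Fin (n i)) :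
    (star x) i a b = star (x i b a) := rfl

/-- The entry `x ↦ x i a b` as a continuous linear map: the slice by a matrix coefficient. -/
def entry (n : ι → ℕ) (N : Type v) [CStarAlgebra N] [PartialOrder N] [StarOrderedRing N]
    (i : ι) (a b : Fin (n i)) : BlockSum n N →L[ℂ] N :=
  LinearMap.mkContinuous
    { toFun := fun x => x i a b
      map_add' := fun _ _ => rfl
      map_smul' := fun _ _ => rfl } 1 fun x => by
    rw [one_mul]
    exact (CStarMatrix.norm_entry_le_norm (M := x i) (i := a) (j := b)).trans
      (lp.norm_apply_le_norm ENNReal.top_ne_zero x i)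

@[simp] theorem entry_apply (i : ι) (a b : Fin (n i)) (x : BlockSum n N) :
    entry n N i a b x = x i a b := rfl

theorem sum_entry {κ : Type*} (s : Finset κ) (x : κ → BlockSum n N) (i : ι) (a b : Fin (n i)) :
    (∑ k ∈ s, x k) i a b = ∑ k ∈ s, x k i a b := map_sum (entry n N i a b) x s

theorem smul_entry (c : ℂ) (x : BlockSum n N) (i : ι) (a b : Fin (n i)) :
    (c • x) i a b = c • x i a b := rfl

@[simp] theorem zero_entry (i : ι) (a b : Fin (n i)) : (0 : BlockSum n N) i a b = 0 := rfl

theorem norm_block_le (x : BlockSum n N) (i : ι) : ‖x i‖ ≤ ‖x‖ :=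
  lp.norm_apply_le_norm ENNReal.top_ne_zero x i

/-- A uniformly bounded family of blocks. -/
def mk (x : ∀ i, CStarMatrix (Fin (n i)) (Fin (n i)) N) (C : ℝ) (h : ∀ i, ‖x i‖ ≤ C) :
    BlockSum n N :=
  ⟨x, memℓp_infty ⟨C, by rintro _ ⟨i, rfl⟩; exact h i⟩⟩

open Classical in
/-- The family concentrated in the block `i`. -/
def single (i : ι) (X : CStarMatrix (Fin (n i)) (Fin (n i)) N) : BlockSum n N :=
  lp.single ∞ i X

@[simp] theorem single_block_self (i : ι) (X : CStarMatrix (Fin (n i)) (Fin (n i)) N) :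
    single i X i = X := by
  classical
  exact lp.single_apply_self (E := fun i => CStarMatrix (Fin (n i)) (Fin (n i)) N) ∞ i X

theorem single_block_ne {i j : ι} (h : j ≠ i) (X : CStarMatrix (Fin (n i)) (Fin (n i)) N) :
    single i X j = 0 := by
  classical
  exact lp.single_apply_ne (E := fun i => CStarMatrix (Fin (n i)) (Fin (n i)) N) ∞ i X h

theorem matUnit_block_ne {i j : ι} (h : j ≠ i) (a b : Fin (n i)) : matUnit n i a b j = 0 := by
  classical
  exact lp.single_apply_ne ∞ i _ h

theorem matUnit_entry (i : ι) (a b c d : Fin (n i)) :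
    matUnit n i a b i c d = if a = c ∧ b = d then 1 else 0 := by
  classical
  have : matUnit n i a b i = CStarMatrix.ofMatrix (Matrix.single a b (1 : ℂ)) :=
    lp.single_apply_self ∞ i _
  rw [this]
  exact Matrix.single_apply ..

/-- The central projection `p_i` onto the `i`-th block. -/
def proj (n : ι → ℕ) (N : Type v) [CStarAlgebra N] [PartialOrder N] [StarOrderedRing N]
    (i : ι) : BlockSum n N := single i 1

@[simp] theorem proj_block_self (i : ι) : proj n N i i = 1 := by simp [proj]

section Unital

variable [∀ i, NeZero (n i)] [Nontrivial N]

@[simp] theorem one_block (i : ι) : (1 : BlockSum n N) i = 1 := rfl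

theorem one_entry (i : ι) (a b : Fin (n i)) : (1 : BlockSum n N) i a b = if a = b then 1 else 0 :=
  rfl

/-- Positivity is a blockwise condition. As `CStarMatrix` carries no order instance, positivity of a
block is expressed by the existence of a factorization `y⋆ y`. -/
theorem nonneg_iff {x : BlockSum n N} : 0 ≤ x ↔ ∀ i, ∃ y, x i = star y * y := by
  rw [CStarAlgebra.nonneg_iff_eq_star_mul_self]
  constructor
  · rintro ⟨y, rfl⟩ i
    exact ⟨y i, rfl⟩
  · intro h
    choose y hy using h
    refine ⟨mk y (Real.sqrt ‖x‖) fun i => ?_, ext hy⟩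
    apply Real.le_sqrt_of_sq_le
    rw [pow_two, ← CStarRing.norm_star_mul_self, ← hy]
    exact norm_block_le x i

theorem proj_mul_block_self (i : ι) (x : BlockSum n N) : (proj n N i * x) i = x i := by
  simp

theorem proj_mul_block_ne {i j : ι} (h : j ≠ i) (x : BlockSum n N) :
    (proj n N i * x) j = 0 := by
  simp [proj, single_block_ne h]

theorem proj_comm (i : ι) (x : BlockSum n N) : proj n N i * x = x * proj n N i := by
  refine ext fun j => ?_
  by_cases hj : j = i
  · subst hj; simp [proj]
  · simp [proj, single_block_ne hj]

theorem proj_mul_proj (i : ι) : proj n N i * proj n N i = proj n N i := by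
  refine ext fun j => ?_
  by_cases hj : j = i
  · subst hj; simp [proj]
  · simp [proj, single_block_ne hj]

theorem proj_mul_proj_ne {i j : ι} (h : i ≠ j) : proj n N i * proj n N j = 0 := by
  refine ext fun k => ?_
  by_cases hk : k = i
  · subst hk; simp [proj, single_block_ne h]
  · simp [proj, single_block_ne hk]

theorem star_proj (i : ι) : star (proj n N i) = proj n N i := by
  refine ext fun j => ?_
  by_cases hj : j = i
  · subst hj; simp [proj]
  · simp [proj, single_block_ne hj]

theorem proj_mul_nonneg (i : ι) {x : BlockSum n N} (h : 0 ≤ x) : 0 ≤ proj n N i * x :=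
  mul_nonneg_of_central_idempotent (star_proj i) (proj_mul_proj i) (proj_comm i x) h

end Unital

end BlockSum

end Entries

/-! ### Normality and weights on sums of matrix algebras -/

section LinearExtension

variable {A : Type v} [CStarAlgebra A] [PartialOrder A] [StarOrderedRing A]

open scoped ComplexStarModule in
/-- An additive, positively homogeneous map on the positive cone of a unital C⋆-algebra which is
finite at `1` extends to a linear functional. -/
theorem exists_linearMap_of_nonneg (τ : A → ℝ≥0∞)
    (hadd : ∀ x y, 0 ≤ x → 0 ≤ y → τ (x + y) = τ x + τ y)
    (hsmul : ∀ (c : ℝ≥0) (x : A), 0 ≤ x → τ (((c : ℝ) : ℂ) • x) = c * τ x)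
    (hone : τ 1 < ∞) :
    ∃ f : A →ₗ[ℂ] ℂ, ∀ x, 0 ≤ x → f x = ((τ x).toReal : ℂ) := by
  have hsmul' : ∀ (r : ℝ) (x : A), 0 ≤ r → 0 ≤ x → τ (r • x) = ENNReal.ofReal r * τ x := by
    intro r x hr hx
    have := hsmul r.toNNReal x hx
    rwa [Real.coe_toNNReal r hr, Complex.coe_smul] at this
  have hone0 : (0 : A) ≤ 1 := zero_le_one
  have hc1 : ∀ c : ℝ, 0 ≤ c → (0 : A) ≤ c • (1 : A) := fun c hc => smul_nonneg hc hone0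
  have hle : ∀ x : A, IsSelfAdjoint x → x ≤ ‖x‖ • (1 : A) := fun x hx => by
    simpa [Algebra.algebraMap_eq_smul_one] using hx.le_algebraMap_norm_self
  have hfin : ∀ x, 0 ≤ x → τ x ≠ ∞ := by
    intro x hx
    have h := hle x (.of_nonneg hx)
    have h2 : τ x + τ (‖x‖ • 1 - x) = ENNReal.ofReal ‖x‖ * τ 1 := by
      rw [← hadd _ _ hx (sub_nonneg.2 h), add_sub_cancel, hsmul' _ _ (norm_nonneg x) hone0]
    have h3 : τ x + τ (‖x‖ • 1 - x) < ∞ := h2 ▸ ENNReal.mul_lt_top ENNReal.ofReal_lt_top hone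
    exact (lt_of_le_of_lt le_self_add h3).ne
  set t : A → ℝ := fun x => (τ x).toReal with ht
  have tadd : ∀ x y, 0 ≤ x → 0 ≤ y → t (x + y) = t x + t y := fun x y hx hy => by
    simp only [ht]
    rw [hadd x y hx hy, ENNReal.toReal_add (hfin x hx) (hfin y hy)]
  have tsmul : ∀ (r : ℝ) (x : A), 0 ≤ r → 0 ≤ x → t (r • x) = r * t x := fun r x hr hx => by
    simp only [ht]
    rw [hsmul' r x hr hx, ENNReal.toReal_mul, ENNReal.toReal_ofReal hr]
  have hpos : ∀ x : A, IsSelfAdjoint x → 0 ≤ x + ‖x‖ • (1 : A) := fun x hx => by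
    have := hle (-x) hx.neg
    rw [norm_neg] at this
    rw [add_comm]
    simpa using sub_nonneg.2 this
  -- the value of the extension at a self-adjoint `x` is `t (x + c) - c t(1)` for any shift `c`
  -- making `x + c` positive
  set g : A → ℝ := fun x => t (x + ‖x‖ • (1 : A)) - ‖x‖ * t 1 with hg
  have gshift : ∀ (x : A) (c : ℝ), IsSelfAdjoint x → 0 ≤ c → 0 ≤ x + c • (1 : A) →
      g x = t (x + c • (1 : A)) - c * t 1 := by
    intro x c hx hc hxc
    have h1 := tadd _ _ (hpos x hx) (hc1 c hc)
    have h2 := tadd _ _ hxc (hc1 _ (norm_nonneg x))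
    rw [tsmul _ _ hc hone0] at h1
    rw [tsmul _ _ (norm_nonneg x) hone0] at h2
    have h3 : x + ‖x‖ • (1 : A) + c • (1 : A) = x + c • (1 : A) + ‖x‖ • (1 : A) := by abel
    rw [h3] at h1
    simp only [hg]
    linarith
  have gpos : ∀ x, 0 ≤ x → g x = t x := fun x hx => by
    rw [gshift x 0 (.of_nonneg hx) le_rfl (by simpa using hx)]
    simp
  have gadd : ∀ x y, IsSelfAdjoint x → IsSelfAdjoint y → g (x + y) = g x + g y := by
    intro x y hx hy
    have h1 : x + y + (‖x‖ + ‖y‖) • (1 : A) = (x + ‖x‖ • (1 : A)) + (y + ‖y‖ • (1 : A)) := by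
      rw [add_smul]; abel
    rw [gshift (x + y) (‖x‖ + ‖y‖) (hx.add hy) (by positivity)
      (h1 ▸ add_nonneg (hpos x hx) (hpos y hy)), h1, tadd _ _ (hpos x hx) (hpos y hy)]
    simp only [hg]
    ring
  have gsmul_nonneg : ∀ (r : ℝ) (x : A), 0 ≤ r → IsSelfAdjoint x → g (r • x) = r * g x := by
    intro r x hr hx
    have h1 : r • x + (r * ‖x‖) • (1 : A) = r • (x + ‖x‖ • (1 : A)) := by
      rw [smul_add, smul_smul]
    rw [gshift (r • x) (r * ‖x‖) ((IsSelfAdjoint.all r).smul hx) (by positivity)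
      (h1 ▸ smul_nonneg hr (hpos x hx)), h1, tsmul _ _ hr (hpos x hx)]
    simp only [hg]
    ring
  have gneg : ∀ x : A, IsSelfAdjoint x → g (-x) = - g x := by
    intro x hx
    have h := gadd x (-x) hx hx.neg
    rw [add_neg_cancel, gpos 0 le_rfl] at h
    have h0 := tsmul 0 0 le_rfl le_rfl
    rw [zero_smul, zero_mul] at h0
    linarith
  have gsmul : ∀ (r : ℝ) (x : A), IsSelfAdjoint x → g (r • x) = r * g x := by
    intro r x hx
    rcases le_total 0 r with hr | hr
    · exact gsmul_nonneg r x hr hx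
    · have h := gsmul_nonneg (-r) x (neg_nonneg.2 hr) hx
      rw [neg_smul, gneg _ ((IsSelfAdjoint.all r).smul hx)] at h
      linarith
  let f : A → ℂ := fun x => (g (ℜ x : A) : ℂ) + Complex.I * (g (ℑ x : A) : ℂ)
  have fadd : ∀ x y, f (x + y) = f x + f y := fun x y => by
    simp only [f, map_add, AddSubgroup.coe_add]
    rw [gadd _ _ (ℜ x).2 (ℜ y).2, gadd _ _ (ℑ x).2 (ℑ y).2]
    push_cast; ring
  have fI : ∀ x, f (Complex.I • x) = Complex.I * f x := fun x => by
    simp only [f, realPart_I_smul, imaginaryPart_I_smul, NegMemClass.coe_neg]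
    rw [gneg _ (ℑ x).2]
    push_cast
    linear_combination (-(g (ℑ x : A)) : ℂ) * Complex.I_mul_I
  have fr : ∀ (r : ℝ) (x : A), f ((r : ℂ) • x) = r * f x := fun r x => by
    rw [Complex.coe_smul]
    simp only [f, map_smul, selfAdjoint.val_smul]
    rw [gsmul _ _ (ℜ x).2, gsmul _ _ (ℑ x).2]
    push_cast; ring
  refine ⟨{ toFun := f, map_add' := fadd, map_smul' := fun c x => ?_ }, fun x hx => ?_⟩
  · conv_lhs => rw [← Complex.re_add_im c, add_smul, mul_smul]
    rw [fadd, fr, fr, fI, RingHom.id_apply, smul_eq_mul]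
    conv_rhs => rw [← Complex.re_add_im c]
    ring
  · have hx' : IsSelfAdjoint x := .of_nonneg hx
    change f x = _
    simp only [f, hx'.coe_realPart, hx'.imaginaryPart, ZeroMemClass.coe_zero]
    rw [gpos x hx, gpos 0 le_rfl]
    have h0 := tsmul 0 0 le_rfl le_rfl
    rw [zero_smul, zero_mul] at h0
    rw [h0]
    simp [ht]

end LinearExtension

section Normality

variable {ι : Type u} {n : ι → ℕ} [∀ i, NeZero (n i)]

namespace BlockSum

instance finiteDimensional_cstarMatrix (k : ℕ) :
    FiniteDimensional ℂ (CStarMatrix (Fin k) (Fin k) ℂ) :=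
  inferInstanceAs (FiniteDimensional ℂ (Matrix (Fin k) (Fin k) ℂ))

theorem isCompact_block (i : ι) (R : ℝ) :
    IsCompact {y : BlockSum n ℂ | proj n ℂ i * y = y ∧ ‖y‖ ≤ R} := by
  let S : CStarMatrix (Fin (n i)) (Fin (n i)) ℂ →ₗ[ℂ] BlockSum n ℂ :=
    { toFun := fun X => single i X
      map_add' := fun X Y => by
        refine ext fun j => ?_
        by_cases hj : j = i
        · subst hj; simp
        · simp [single_block_ne hj]
      map_smul' := fun c X => by
        refine ext fun j => ?_
        by_cases hj : j = i
        · subst hj; simp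
        · simp [single_block_ne hj] }
  have hS : Continuous S := S.continuous_of_finiteDimensional
  have : ProperSpace (CStarMatrix (Fin (n i)) (Fin (n i)) ℂ) := FiniteDimensional.proper ℂ _
  refine ((isCompact_closedBall (0 : CStarMatrix (Fin (n i)) (Fin (n i)) ℂ) R).image
    hS).of_isClosed_subset ?_ ?_
  · exact (isClosed_eq (continuous_const.mul continuous_id) continuous_id).inter
      (isClosed_le continuous_norm continuous_const)
  · rintro y ⟨hy, hR⟩
    refine ⟨y i, ?_, ?_⟩
    · rw [mem_closedBall_zero_iff]
      exact (norm_block_le y i).trans hR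
    · refine ext fun j => ?_
      by_cases hj : j = i
      · subst hj; exact single_block_self j _
      · rw [← hy, proj_mul_block_ne hj]
        exact single_block_ne hj _

/-- Along a directed set with supremum `a`, the blocks of `a - d` accumulate at `0` in norm: by
compactness of balls in a block there is a cluster point `L ≥ 0`, and `a - L` is again an upper
bound, so `L = 0`. -/
theorem zero_mem_of_isLUB {D : Set (BlockSum n ℂ)} (hD : D.Nonempty)
    (hdir : DirectedOn (· ≤ ·) D) {a : BlockSum n ℂ} (ha : IsLUB D a) (i : ι)
    {C : Set (BlockSum n ℂ)} (hC : IsClosed C) (h : ∀ d ∈ D, proj n ℂ i * (a - d) ∈ C) :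
    0 ∈ C := by
  obtain ⟨d₀, hd₀⟩ := hD
  have : Nonempty D := ⟨⟨d₀, hd₀⟩⟩
  have : IsDirectedOrder D := directedOn_univ_iff.1 fun x _ y _ => by
    obtain ⟨z, hz, hxz, hyz⟩ := hdir x.1 x.2 y.1 y.2
    exact ⟨⟨z, hz⟩, trivial, hxz, hyz⟩
  let f : D → BlockSum n ℂ := fun d => proj n ℂ i * (a - d.1)
  have hnn : ∀ d : D, 0 ≤ a - d.1 := fun d => sub_nonneg.2 (ha.1 d.2)
  have hf : ∀ d : D, 0 ≤ f d := fun d => proj_mul_nonneg i (hnn d)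
  have hmono : ∀ d e : D, d ≤ e → f e ≤ f d := fun d e hde => by
    rw [← sub_nonneg]
    have : f d - f e = proj n ℂ i * (e.1 - d.1) := by
      simp only [f, ← mul_sub]; congr 1; abel
    rw [this]
    exact proj_mul_nonneg i (sub_nonneg.2 hde)
  have hle : ∀ d : D, f d ≤ a - d.1 := fun d => by
    rw [← sub_nonneg, nonneg_iff]
    intro j
    by_cases hj : j = i
    · subst hj
      exact ⟨0, by simp [f]⟩
    · obtain ⟨y, hy⟩ := nonneg_iff.1 (hnn d) j
      refine ⟨y, ?_⟩
      rw [sub_block, proj_mul_block_ne hj, sub_zero, hy]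
  have hev : ∀ᶠ d in Filter.atTop, f d ∈
      {y : BlockSum n ℂ | proj n ℂ i * y = y ∧ ‖y‖ ≤ ‖f ⟨d₀, hd₀⟩‖} := by
    filter_upwards [Filter.eventually_ge_atTop (⟨d₀, hd₀⟩ : D)] with d hd
    refine ⟨by simp only [f]; rw [← mul_assoc, proj_mul_proj], ?_⟩
    exact CStarAlgebra.norm_le_norm_of_nonneg_of_le (hf d) (hmono _ _ hd)
  obtain ⟨L, -, hL⟩ := (isCompact_block i ‖f ⟨d₀, hd₀⟩‖).exists_mapClusterPt_of_frequently
    hev.frequently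
  have key : ∀ S : Set (BlockSum n ℂ), IsClosed S → (∀ᶠ d in Filter.atTop, f d ∈ S) → L ∈ S :=
    fun S hS hev => isClosed_iff_clusterPt.1 hS L
      (ClusterPt.mono hL (Filter.tendsto_principal.2 hev))
  have hL0 : 0 ≤ L := key {y | 0 ≤ y} (CStarAlgebra.isClosed_nonneg) (.of_forall hf)
  have hLd : ∀ d : D, L ≤ a - d.1 := fun d => by
    have hcl : IsClosed {y : BlockSum n ℂ | 0 ≤ a - d.1 - y} :=
      CStarAlgebra.isClosed_nonneg.preimage (continuous_const.sub continuous_id)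
    refine sub_nonneg.1 (key _ hcl ?_)
    filter_upwards [Filter.eventually_ge_atTop d] with e he
    exact sub_nonneg.2 ((hmono d e he).trans (hle d))
  have h1 : a ≤ a - L := ha.2 fun d hd => by
    have := hLd ⟨d, hd⟩
    rw [le_sub_comm] at this
    exact this
  have hL' : L = 0 := le_antisymm (by simpa using sub_nonneg.2 h1) hL0
  exact hL' ▸ key C hC (.of_forall fun d => h d.1 d.2)

/-- A positive functional which only sees one block is normal. -/
theorem isNormalMap_of_block (ω : BlockSum n ℂ →L[ℂ] ℂ) (hω : ∀ x, 0 ≤ x → 0 ≤ ω x) (i : ι)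
    (hi : ∀ x, ω (proj n ℂ i * x) = ω x) : IsNormalMap ω := by
  have hmono : ∀ x y, x ≤ y → ω x ≤ ω y := fun x y hxy => by
    rw [← sub_nonneg, ← map_sub]; exact hω _ (sub_nonneg.2 hxy)
  intro D hD hdir _ a ha
  refine ⟨?_, fun c hc => ?_⟩
  · rintro _ ⟨d, hd, rfl⟩
    exact hmono _ _ (ha.1 hd)
  · have hcl : IsClosed {y : BlockSum n ℂ | ω a - c ≤ ω y} :=
      isClosed_le continuous_const ω.continuous
    have h0 := zero_mem_of_isLUB hD hdir ha i hcl fun d hd => by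
      change ω a - c ≤ ω _
      rw [hi, map_sub]
      exact sub_le_sub_left (hc ⟨d, hd, rfl⟩) _
    simpa using h0

theorem isLUB_sum_proj_mul {x : BlockSum n ℂ} (hx : 0 ≤ x) :
    IsLUB (Set.range fun S : Finset ι => ∑ i ∈ S, proj n ℂ i * x) x := by
  classical
  have hblock : ∀ (S : Finset ι) (j : ι), (∑ i ∈ S, proj n ℂ i * x) j =
      if j ∈ S then x j else 0 := by
    intro S j
    refine CStarMatrix.ext fun a b => ?_
    rw [sum_entry]
    split_ifs with hj
    · rw [Finset.sum_eq_single_of_mem j hj fun i _ hij => by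
        rw [proj_mul_block_ne hij.symm]; rfl, proj_mul_block_self]
    · exact Finset.sum_eq_zero fun i hi => by
        rw [proj_mul_block_ne (fun h : j = i => hj (h ▸ hi))]; rfl
  refine ⟨?_, fun y hy => ?_⟩
  · rintro _ ⟨S, rfl⟩
    rw [← sub_nonneg, nonneg_iff]
    intro j
    rw [sub_block, hblock]
    split_ifs with hj
    · exact ⟨0, by simp⟩
    · simpa using nonneg_iff.1 hx j
  · rw [← sub_nonneg, nonneg_iff]
    intro j
    have h1 := sub_nonneg.2 (hy ⟨{j}, rfl⟩)
    have h2 := nonneg_iff.1 h1 j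
    simpa using h2

theorem directedOn_sum_proj_mul {x : BlockSum n ℂ} (hx : 0 ≤ x) :
    DirectedOn (· ≤ ·) (Set.range fun S : Finset ι => ∑ i ∈ S, proj n ℂ i * x) := by
  classical
  rw [directedOn_range]
  exact Monotone.directed_le fun S T hST =>
    Finset.sum_le_sum_of_subset_of_nonneg hST fun i _ _ => proj_mul_nonneg i hx

end BlockSum

end Normality

namespace NSFWeight

variable {ι : Type u} {n : ι → ℕ} [∀ i, NeZero (n i)] (φ : NSFWeight (BlockSum n ℂ))

open BlockSum

theorem mono {x y : BlockSum n ℂ} (hx : 0 ≤ x) (hxy : x ≤ y) : φ.toFun x ≤ φ.toFun y := by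
  have h := φ.map_add x (y - x) hx (sub_nonneg.2 hxy)
  rw [add_sub_cancel] at h
  exact h ▸ le_self_add

/-- Semi-finiteness forces finiteness on the blocks, as these are finite dimensional. -/
theorem proj_lt_top (i : ι) : φ.toFun (proj n ℂ i) < ∞ := by
  obtain ⟨D, hD, hdir, hfin, hlub⟩ := φ.semifinite
  have hone0 : (0 : BlockSum n ℂ) ≤ 1 := zero_le_one
  obtain ⟨d, hd, hlt⟩ : ∃ d ∈ D, ‖proj n ℂ i * (1 - d)‖ < 1 / 2 := by
    by_contra! hcon
    have := zero_mem_of_isLUB hD hdir hlub i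
      (isClosed_le continuous_const continuous_norm : IsClosed {y | (1 / 2 : ℝ) ≤ ‖y‖}) hcon
    norm_num at this
  have hp0 : 0 ≤ proj n ℂ i * (1 - d) := proj_mul_nonneg i (sub_nonneg.2 (hlub.1 hd))
  have h1 : proj n ℂ i * (1 - d) ≤ (1 / 2 : ℝ) • (1 : BlockSum n ℂ) := by
    refine (IsSelfAdjoint.of_nonneg hp0).le_algebraMap_norm_self.trans ?_
    rw [Algebra.algebraMap_eq_smul_one]
    exact smul_le_smul_of_nonneg_right hlt.le hone0
  have h2 : 0 ≤ d - (1 / 2 : ℝ) • proj n ℂ i := by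
    have h3 := proj_mul_nonneg i (sub_nonneg.2 h1)
    rw [nonneg_iff] at h3 ⊢
    intro j
    by_cases hj : j = i
    · subst hj
      obtain ⟨y, hy⟩ := h3 j
      refine ⟨y, hy ▸ ?_⟩
      rw [proj_mul_block_self, sub_block, sub_block, proj_mul_block_self, sub_block, one_block]
      have e1 : ((1 / 2 : ℝ) • (1 : BlockSum n ℂ)) j =
          (1 / 2 : ℝ) • (1 : CStarMatrix (Fin (n j)) (Fin (n j)) ℂ) := rfl
      have e2 : ((1 / 2 : ℝ) • proj n ℂ j) j =
          (1 / 2 : ℝ) • (1 : CStarMatrix (Fin (n j)) (Fin (n j)) ℂ) := by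
        have : ((1 / 2 : ℝ) • proj n ℂ j) j = (1 / 2 : ℝ) • (proj n ℂ j j) := rfl
        rw [this]; simp [proj]
      rw [e1, e2]
      have e3 : ∀ h o z : CStarMatrix (Fin (n j)) (Fin (n j)) ℂ, o = h + h →
          h - (o - z) = z - h := by
        rintro h _ z rfl
        abel
      refine (e3 _ _ _ ?_).symm
      rw [← add_smul]; norm_num
    · obtain ⟨y, hy⟩ := nonneg_iff.1 (hfin d hd).1 j
      refine ⟨y, ?_⟩
      have e2 : ((1 / 2 : ℝ) • proj n ℂ i) j = 0 := by
        have : ((1 / 2 : ℝ) • proj n ℂ i) j = (1 / 2 : ℝ) • (proj n ℂ i j) := rfl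
        rw [this]; simp [proj, single_block_ne hj]
      rw [sub_block, e2, sub_zero, hy]
  have hp : (0 : BlockSum n ℂ) ≤ proj n ℂ i := by simpa using proj_mul_nonneg i hone0
  have h4 : φ.toFun ((1 / 2 : ℝ) • proj n ℂ i) < ∞ :=
    (φ.mono (smul_nonneg (by norm_num) hp) (sub_nonneg.1 h2)).trans_lt (hfin d hd).2
  have h5 := φ.map_smul (1 / 2) (proj n ℂ i) hp
  rw [Complex.coe_smul] at h5
  have h6 : ((1 / 2 : ℝ≥0) : ℝ) = 1 / 2 := by norm_num
  rw [h6] at h5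
  rw [h5] at h4
  exact ENNReal.lt_top_of_mul_ne_top_right h4.ne (by norm_num)

theorem proj_mul_lt_top (i : ι) {x : BlockSum n ℂ} (hx : 0 ≤ x) :
    φ.toFun (proj n ℂ i * x) < ∞ := by
  have hone0 : (0 : BlockSum n ℂ) ≤ 1 := zero_le_one
  have hp : (0 : BlockSum n ℂ) ≤ proj n ℂ i := by simpa using proj_mul_nonneg i hone0
  have h := (IsSelfAdjoint.of_nonneg hx).le_algebraMap_norm_self
  rw [Algebra.algebraMap_eq_smul_one] at h
  have h2 := proj_mul_nonneg i (sub_nonneg.2 h)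
  rw [mul_sub, mul_smul_comm, mul_one, sub_nonneg] at h2
  refine (φ.mono (proj_mul_nonneg i hx) h2).trans_lt ?_
  have h3 := φ.map_smul ‖x‖₊ (proj n ℂ i) hp
  rw [Complex.coe_smul, coe_nnnorm] at h3
  rw [h3]
  exact ENNReal.mul_lt_top ENNReal.coe_lt_top (φ.proj_lt_top i)

/-- Normality: a weight is the sum of its restrictions to the blocks. -/
theorem eq_tsum {x : BlockSum n ℂ} (hx : 0 ≤ x) :
    φ.toFun x = ∑' i, φ.toFun (proj n ℂ i * x) := by
  classical
  have hpx : ∀ i, 0 ≤ proj n ℂ i * x := fun i => proj_mul_nonneg i hx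
  have hsum : ∀ S : Finset ι, φ.toFun (∑ i ∈ S, proj n ℂ i * x) =
      ∑ i ∈ S, φ.toFun (proj n ℂ i * x) := by
    intro S
    induction S using Finset.induction_on with
    | empty =>
      have := φ.map_smul 0 0 le_rfl
      simpa using this
    | insert i S hi ih =>
      rw [Finset.sum_insert hi, Finset.sum_insert hi,
        φ.map_add _ _ (hpx i) (Finset.sum_nonneg fun j _ => hpx j), ih]
  have h := φ.normal _ ⟨_, Set.mem_range_self ∅⟩ (directedOn_sum_proj_mul hx)
    (by rintro _ ⟨S, rfl⟩; exact Finset.sum_nonneg fun i _ => hpx i) x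
    (isLUB_sum_proj_mul hx)
  rw [← Set.range_comp] at h
  rw [ENNReal.tsum_eq_iSup_sum, ← h.iSup_eq]
  exact iSup_congr hsum

/-- The restriction of the weight to a block is (the restriction of) a linear functional. -/
theorem exists_linearMap (i : ι) : ∃ f : BlockSum n ℂ →ₗ[ℂ] ℂ, ∀ x, 0 ≤ x →
    f x = ((φ.toFun (proj n ℂ i * x)).toReal : ℂ) := by
  refine exists_linearMap_of_nonneg (fun x => φ.toFun (proj n ℂ i * x)) ?_ ?_ ?_
  · intro x y hx hy
    rw [mul_add]
    exact φ.map_add _ _ (proj_mul_nonneg i hx) (proj_mul_nonneg i hy)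
  · intro c x hx
    rw [mul_smul_comm]
    exact φ.map_smul _ _ (proj_mul_nonneg i hx)
  · simpa using φ.proj_lt_top i

end NSFWeight

/-! ### Isometries from invariance -/

theorem sum_polarization {m : ℕ} (T : Fin m → Fin m → ℂ) (a b : Fin m) (ζ : ℂ) :
    ∑ p, ∑ q, star ((Pi.single a 1 + Pi.single b ζ : Fin m → ℂ) p) *
      (Pi.single a 1 + Pi.single b ζ : Fin m → ℂ) q * T p q =
    T a a + ζ * T a b + star ζ * T b a + star ζ * ζ * T b b := by
  have h : ∀ p q, star ((Pi.single a 1 + Pi.single b ζ : Fin m → ℂ) p) *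
      (Pi.single a 1 + Pi.single b ζ : Fin m → ℂ) q * T p q =
      (if p = a then if q = a then T p q else 0 else 0) +
      (if p = a then if q = b then ζ * T p q else 0 else 0) +
      (if p = b then if q = a then star ζ * T p q else 0 else 0) +
      (if p = b then if q = b then star ζ * ζ * T p q else 0 else 0) := by
    intro p q
    simp only [Pi.add_apply, Pi.single_apply]
    split_ifs <;> simp <;> ring
  simp only [h, Finset.sum_add_distrib]
  simp

/-- Polarization: convergence of a family of quadratic forms implies convergence of all matrix
entries. -/
theorem hasSum_of_forall_quadratic {κ : Type*} {m : ℕ} (T : κ → Fin m → Fin m → ℂ)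
    (L : Fin m → Fin m → ℂ)
    (h : ∀ ξ : Fin m → ℂ, HasSum (fun j => ∑ p, ∑ q, star (ξ p) * ξ q * T j p q)
      (∑ p, ∑ q, star (ξ p) * ξ q * L p q)) (a b : Fin m) :
    HasSum (fun j => T j a b) (L a b) := by
  have h' : ∀ ζ : ℂ, HasSum
      (fun j => T j a a + ζ * T j a b + star ζ * T j b a + star ζ * ζ * T j b b)
      (L a a + ζ * L a b + star ζ * L b a + star ζ * ζ * L b b) := fun ζ => by
    have := h (Pi.single a 1 + Pi.single b ζ)
    simpa only [sum_polarization] using this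
  have key := (((h' 1).sub (h' (-1))).mul_left (1 / 4)).add
    (((h' Complex.I).sub (h' (-Complex.I))).mul_left (-Complex.I / 4))
  have hI : Complex.I ^ 2 = -1 := Complex.I_sq
  have e : ∀ x y z w : ℂ, 1 / 4 * (x + 1 * y + star 1 * z + star 1 * 1 * w -
      (x + -1 * y + star (-1) * z + star (-1) * -1 * w)) +
      -Complex.I / 4 * (x + Complex.I * y + star Complex.I * z + star Complex.I * Complex.I * w -
      (x + -Complex.I * y + star (-Complex.I) * z + star (-Complex.I) * -Complex.I * w)) = y := by
    intro x y z w
    simp only [star_one, star_neg, Complex.star_def, Complex.conj_I]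
    ring_nf
    rw [hI]
    ring
  simpa only [e] using key

namespace NSFWeight

variable {ι : Type u} {n : ι → ℕ} [∀ i, NeZero (n i)] (φ : NSFWeight (BlockSum n ℂ))

open BlockSum

/-- If `π` is the coefficient matrix of a ⋆-homomorphism into `m × m` matrices over `⨁ᵢ M_{n i}(ℂ)`
along which the weight `φ` is invariant, then `e_a ⊗ y ↦ ∑_c e_c ⊗ π_{ca}(y)` is injective on each
block: it is isometric for the inner product `∑_a φ(y_a⋆ y_a)`. -/
theorem eq_zero_of_invariant {m : ℕ} (π : Fin m → Fin m → BlockSum n ℂ →ₗ[ℂ] BlockSum n ℂ)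
    (hmul : ∀ x y a b, π a b (star x * y) = ∑ c, star (π c a x) * π c b y)
    (hinv : ∀ (ξ : Fin m → ℂ) (x : BlockSum n ℂ), 0 ≤ x → φ.toFun x < ∞ →
      φ.toFun (∑ a, ∑ b, (star (ξ a) * ξ b) • π a b x) =
        ENNReal.ofReal (∑ a, ‖ξ a‖ ^ 2) * φ.toFun x)
    (k : ι) (y : Fin m → BlockSum n ℂ) (hy : ∀ a, proj n ℂ k * y a = y a)
    (h0 : ∀ c, ∑ a, π c a (y a) = 0) : y = 0 := by
  have hpos : ∀ (ξ : Fin m → ℂ) (x : BlockSum n ℂ), 0 ≤ x →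
      0 ≤ ∑ a, ∑ b, (star (ξ a) * ξ b) • π a b x := by
    intro ξ x hx
    obtain ⟨z, rfl⟩ := CStarAlgebra.nonneg_iff_eq_star_mul_self.1 hx
    have : ∑ a, ∑ b, (star (ξ a) * ξ b) • π a b (star z * z) =
        ∑ c, star (∑ a, ξ a • π c a z) * ∑ b, ξ b • π c b z := by
      simp only [hmul, Finset.smul_sum, star_sum, star_smul, Finset.sum_mul_sum,
        smul_mul_smul_comm]
      rw [Finset.sum_comm_cycle]
    rw [this]
    exact Finset.sum_nonneg fun c _ => star_mul_self_nonneg _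
  choose f hf using φ.exists_linearMap
  -- invariance for positive `x`, summed over the blocks of the second leg
  have hquad : ∀ (ξ : Fin m → ℂ) (x : BlockSum n ℂ), 0 ≤ x →
      HasSum (fun j => ∑ a, ∑ b, star (ξ a) * ξ b * f j (π a b (proj n ℂ k * x)))
        (∑ a, ∑ b, star (ξ a) * ξ b * (if a = b then f k x else 0)) := by
    intro ξ x hx
    set w := proj n ℂ k * x with hw
    have hw0 : 0 ≤ w := proj_mul_nonneg k hx
    have hwfin : φ.toFun w < ∞ := φ.proj_mul_lt_top k hx
    have hz := hpos ξ w hw0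
    have h1 := hinv ξ w hw0 hwfin
    rw [φ.eq_tsum hz] at h1
    have hne : ∑' j, φ.toFun (proj n ℂ j * ∑ a, ∑ b, (star (ξ a) * ξ b) • π a b w) ≠ ∞ :=
      h1 ▸ (ENNReal.mul_lt_top ENNReal.ofReal_lt_top hwfin).ne
    have h2 := ENNReal.hasSum_toReal hne
    rw [← ENNReal.tsum_toReal_eq (ENNReal.ne_top_of_tsum_ne_top hne), h1, ENNReal.toReal_mul,
      ENNReal.toReal_ofReal (Finset.sum_nonneg fun a _ => by positivity)] at h2
    have h3 := Complex.hasSum_ofReal.2 h2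
    convert! h3 using 1
    · funext j
      rw [← hf j _ hz]
      simp only [map_sum]
      exact Finset.sum_congr rfl fun a _ => Finset.sum_congr rfl fun b _ =>
        ((f j).map_smul _ _).symm
    · have h4 : ∀ a, star (ξ a) * ξ a = ((‖ξ a‖ ^ 2 : ℝ) : ℂ) := fun a => by
        rw [Complex.star_def, Complex.conj_mul']; norm_cast
      simp only [mul_ite, mul_zero, Finset.sum_ite_eq, Finset.mem_univ, if_true]
      rw [← Finset.sum_mul, hf k x hx]
      simp only [h4]
      push_cast
      rfl
  -- positive elements span, so polarization in both legs applies
  have hbil : ∀ (x : BlockSum n ℂ) (a b : Fin m),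
      HasSum (fun j => f j (π a b (proj n ℂ k * x))) (if a = b then f k x else 0) := by
    intro x
    have hx : x ∈ Submodule.span ℂ {x : BlockSum n ℂ | 0 ≤ x} := by
      rw [CStarAlgebra.span_nonneg]; trivial
    induction hx using Submodule.span_induction with
    | mem x hx =>
      exact hasSum_of_forall_quadratic (fun j a b => f j (π a b (proj n ℂ k * x)))
        (fun a b => if a = b then f k x else 0) fun ξ => hquad ξ x hx
    | zero =>
      intro a b
      simp only [mul_zero, map_zero, ite_self]
      exact hasSum_zero
    | add x y _ _ hx hy =>
      intro a b
      convert! (hx a b).add (hy a b) using 1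
      · funext j
        rw [mul_add]
        exact ((f j) ∘ₗ π a b).map_add _ _
      · split_ifs
        · exact (f k).map_add _ _
        · simp
    | smul c x _ hx =>
      intro a b
      convert! (hx a b).mul_left c using 1
      · funext j
        rw [mul_smul_comm]
        exact ((f j) ∘ₗ π a b).map_smul _ _
      · split_ifs
        · exact (f k).map_smul _ _
        · simp
  have hpy : ∀ a b, proj n ℂ k * (star (y a) * y b) = star (y a) * y b := fun a b => by
    rw [← mul_assoc, proj_comm, mul_assoc, hy]
  have hz : ∑ a, ∑ b, π a b (star (y a) * y b) = 0 := by
    have : ∑ a, ∑ b, π a b (star (y a) * y b) =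
        ∑ c, star (∑ a, π c a (y a)) * ∑ b, π c b (y b) := by
      simp only [hmul, star_sum, Finset.sum_mul_sum]
      rw [Finset.sum_comm_cycle]
    rw [this]
    exact Finset.sum_eq_zero fun c _ => by rw [h0, mul_zero]
  -- the squared norm of the image of `y` is the value of the weight at `hz`
  have hsum := hasSum_sum (s := Finset.univ) fun a _ =>
    hasSum_sum (s := Finset.univ) fun b _ => hbil (star (y a) * y b) a b
  have h5 : ∑ a, f k (star (y a) * y a) = 0 := by
    have h6 : HasSum (fun _ : ι => (0 : ℂ)) (∑ a, f k (star (y a) * y a)) := by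
      convert! hsum using 1
      · funext j
        simp only [hpy]
        simp only [← map_sum, hz, map_zero]
      · simp
    exact h6.unique hasSum_zero
  have hnn : ∀ a, 0 ≤ star (y a) * y a := fun a => star_mul_self_nonneg _
  have h7 : ∑ a, (φ.toFun (star (y a) * y a)).toReal = 0 := by
    have h8 : ∀ a, f k (star (y a) * y a) = ((φ.toFun (star (y a) * y a)).toReal : ℂ) :=
      fun a => by rw [hf k _ (hnn a), hpy]
    simp only [h8] at h5
    exact_mod_cast h5
  funext a
  have h9 := (Finset.sum_eq_zero_iff_of_nonneg fun a _ => ENNReal.toReal_nonneg).1 h7 a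
    (Finset.mem_univ a)
  have hfin : φ.toFun (star (y a) * y a) < ∞ := hpy a a ▸ φ.proj_mul_lt_top k (hnn a)
  have h10 := (ENNReal.toReal_eq_zero_iff _).1 h9
  have h11 := φ.faithful _ (hnn a) (h10.resolve_right hfin.ne)
  exact CStarRing.star_mul_self_eq_zero_iff _ |>.1 h11

end NSFWeight

/-! ### Finitely supported functionals and duality -/

section FinitelySupported

variable {ι : Type u} {n : ι → ℕ}

open BlockSum

/-- A functional on `⨁ᵢ M_{n i}(ℂ)` which only depends on finitely many blocks. -/
def FinitelySupported (ω : BlockSum n ℂ → ℂ) : Prop :=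
  ∃ F : Finset ι, ∀ x, (∀ k ∈ F, x k = 0) → ω x = 0

theorem finitelySupported_entry (i : ι) (a b : Fin (n i)) :
    FinitelySupported (entry n ℂ i a b) :=
  ⟨{i}, fun x hx => by rw [entry_apply, hx i (Finset.mem_singleton_self i)]; rfl⟩

theorem FinitelySupported.sum {κ : Type*} (s : Finset κ) {ω : κ → BlockSum n ℂ →L[ℂ] ℂ}
    (h : ∀ k, FinitelySupported (ω k)) :
    FinitelySupported (∑ k ∈ s, ω k : BlockSum n ℂ →L[ℂ] ℂ) := by
  classical
  choose F hF using h
  refine ⟨s.biUnion F, fun x hx => ?_⟩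
  rw [sum_apply]
  exact Finset.sum_eq_zero fun k hk => hF k x fun i hi => hx i (Finset.mem_biUnion.2 ⟨k, hk, hi⟩)

theorem sum_matUnit_block (x : BlockSum n ℂ) (F : Finset ι) (k : ι) (hk : k ∈ F) :
    (∑ i ∈ F, ∑ a, ∑ b, x i a b • matUnit n i a b) k = x k := by
  refine CStarMatrix.ext fun c d => ?_
  rw [sum_entry, Finset.sum_eq_single_of_mem k hk fun i _ hik => ?_]
  · simp only [sum_entry, smul_entry, matUnit_entry, smul_eq_mul, mul_ite, mul_one, mul_zero,
      ite_and]
    simp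
  · simp only [sum_entry, smul_entry, matUnit_block_ne hik.symm]
    simp

/-- A finitely supported linear functional is determined by its values at the matrix units. -/
theorem apply_eq_sum_of_support (ω : BlockSum n ℂ →ₗ[ℂ] ℂ) {F : Finset ι}
    (hF : ∀ x, (∀ k ∈ F, x k = 0) → ω x = 0) (x : BlockSum n ℂ) :
    ω x = ∑ i ∈ F, ∑ a, ∑ b, ω (matUnit n i a b) * x i a b := by
  have h : ω (x - ∑ i ∈ F, ∑ a, ∑ b, x i a b • matUnit n i a b) = 0 := hF _ fun k hk => by
    rw [sub_block, sum_matUnit_block x F k hk, sub_self]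
  rw [map_sub, sub_eq_zero] at h
  rw [h]
  simp only [map_sum, map_smul, smul_eq_mul, mul_comm]

variable {N : Type v} [CStarAlgebra N] [PartialOrder N] [StarOrderedRing N]

/-- For finitely supported functionals the series defining the left slice is a finite sum. -/
theorem leftSlice_eq_sum (ω : BlockSum n ℂ → ℂ) {F : Finset ι}
    (hF : ∀ x, (∀ k ∈ F, x k = 0) → ω x = 0) (X : BlockSum n N) :
    leftSlice ω X = ∑ i ∈ F, ∑ a, ∑ b, ω (matUnit n i a b) • X i a b := by
  refine tsum_eq_sum fun i hi => ?_
  refine Finset.sum_eq_zero fun a _ => Finset.sum_eq_zero fun b _ => ?_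
  rw [hF _ fun k hk => matUnit_block_ne (fun h : k = i => hi (h ▸ hk)) a b, zero_smul]

theorem rightSlice_entry (θ : N →L[ℂ] ℂ) (X : BlockSum n N) (i : ι) (a b : Fin (n i)) :
    rightSlice θ X i a b = θ (X i a b) := rfl

/-- `θ ∘ (ω ⊗ id) = ω ∘ (id ⊗ θ)`. -/
theorem apply_leftSlice (ω : BlockSum n ℂ →ₗ[ℂ] ℂ) (hω : FinitelySupported ω)
    (θ : N →L[ℂ] ℂ) (X : BlockSum n N) : θ (leftSlice ω X) = ω (rightSlice θ X) := by
  obtain ⟨F, hF⟩ := hω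
  rw [leftSlice_eq_sum _ hF, apply_eq_sum_of_support ω hF]
  simp only [map_sum, map_smul, smul_eq_mul, rightSlice_entry]

end FinitelySupported

section Preimage

variable {ι : Type u} {n : ι → ℕ} [∀ i, NeZero (n i)]

open BlockSum

theorem proj_mul_eq_sum (k : ι) (x : BlockSum n ℂ) :
    proj n ℂ k * x = ∑ a, ∑ b, x k a b • matUnit n k a b := by
  refine ext fun j => ?_
  by_cases hj : j = k
  · subst hj
    have := sum_matUnit_block x {j} j (Finset.mem_singleton_self j)
    rw [Finset.sum_singleton] at this
    rw [this, proj_mul_block_self]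
  · rw [proj_mul_block_ne hj]
    refine CStarMatrix.ext fun c d => ?_
    simp only [sum_entry, smul_entry, matUnit_block_ne hj]
    simp

theorem proj_mul_matUnit (k : ι) (a b : Fin (n k)) :
    proj n ℂ k * matUnit n k a b = matUnit n k a b := by
  refine ext fun j => ?_
  by_cases hj : j = k
  · subst hj; rw [proj_mul_block_self]
  · rw [proj_mul_block_ne hj, matUnit_block_ne hj]

/-- Duality: if `y ↦ (∑_a T_{ca}(y_a))_c` is injective on the block `k` and `T` is compatible with
the projection onto this block, then the transposed map on tuples of finitely supported functionals
hits every tuple of functionals of the block `k`. The range of the transposed map is graded by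
the blocks, so that this is a statement about a finite dimensional space. -/
theorem exists_sum_comp_eq {m : ℕ} (T : Fin m → Fin m → BlockSum n ℂ →ₗ[ℂ] BlockSum n ℂ) (k : ι)
    (hinj : ∀ y : Fin m → BlockSum n ℂ, (∀ a, proj n ℂ k * y a = y a) →
      (∀ c, ∑ a, T c a (y a) = 0) → y = 0)
    (q : Fin m → Fin m → BlockSum n ℂ →L[ℂ] BlockSum n ℂ)
    (hq : ∀ c d x l, x l = 0 → q c d x l = 0)
    (hT : ∀ c a x, T c a (proj n ℂ k * x) = ∑ d, q c d (T d a x))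
    (w : Fin m → Fin (n k) → Fin (n k) → ℂ) :
    ∃ v : Fin m → BlockSum n ℂ →L[ℂ] ℂ, (∀ c, FinitelySupported (v c)) ∧
      ∀ a x, ∑ c, v c (T c a x) = ∑ r, ∑ s, w a r s * x k r s := by
  classical
  let Im : Submodule ℂ (Fin m → Fin (n k) → Fin (n k) → ℂ) :=
    { carrier := {w | ∃ v : Fin m → BlockSum n ℂ →L[ℂ] ℂ, (∀ c, FinitelySupported (v c)) ∧
        ∀ a x, ∑ c, v c (T c a x) = ∑ r, ∑ s, w a r s * x k r s}
      zero_mem' := ⟨0, fun c => ⟨∅, fun x _ => rfl⟩, fun a x => by simp⟩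
      add_mem' := by
        rintro w₁ w₂ ⟨v₁, h₁, e₁⟩ ⟨v₂, h₂, e₂⟩
        refine ⟨v₁ + v₂, fun c => ?_, fun a x => ?_⟩
        · obtain ⟨F₁, hF₁⟩ := h₁ c
          obtain ⟨F₂, hF₂⟩ := h₂ c
          refine ⟨F₁ ∪ F₂, fun x hx => ?_⟩
          rw [Pi.add_apply, add_apply,
            hF₁ x fun k hk => hx k (Finset.mem_union_left _ hk),
            hF₂ x fun k hk => hx k (Finset.mem_union_right _ hk), add_zero]
        · simp only [Pi.add_apply, add_apply, Finset.sum_add_distrib, e₁, e₂,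
            add_mul]
      smul_mem' := by
        rintro t w₁ ⟨v₁, h₁, e₁⟩
        refine ⟨t • v₁, fun c => ?_, fun a x => ?_⟩
        · obtain ⟨F₁, hF₁⟩ := h₁ c
          refine ⟨F₁, fun x hx => ?_⟩
          rw [Pi.smul_apply, smul_apply, hF₁ x hx, smul_zero]
        · simp only [Pi.smul_apply, smul_apply, smul_eq_mul, ← Finset.mul_sum,
            e₁, mul_assoc] }
  suffices h : Im = ⊤ by
    have : w ∈ Im := h ▸ Submodule.mem_top
    exact this
  by_contra hne
  obtain ⟨f, hf0, hf⟩ := Submodule.exists_le_ker_of_lt_top Im (lt_top_iff_ne_top.2 hne)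
  let E : Fin m → Fin (n k) → Fin (n k) → (Fin m → Fin (n k) → Fin (n k) → ℂ) :=
    fun a r s => Pi.single a (Pi.single r (Pi.single s 1))
  have hE : ∀ W : Fin m → Fin (n k) → Fin (n k) → ℂ,
      W = ∑ a, ∑ r, ∑ s, W a r s • E a r s := by
    intro W
    funext a r s
    simp [E, Finset.sum_apply, Pi.single_apply, ite_apply]
  -- a functional `f` on the tuples of functionals of the block `k` is evaluation at a tuple `y` of
  -- elements of this block
  let y : Fin m → BlockSum n ℂ := fun a => ∑ r, ∑ s, f (E a r s) • matUnit n k r s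
  have hfW : ∀ W : Fin m → Fin (n k) → Fin (n k) → ℂ,
      f W = ∑ a, ∑ r, ∑ s, W a r s * f (E a r s) := by
    intro W
    conv_lhs => rw [hE W]
    simp only [map_sum, map_smul, smul_eq_mul]
  -- gradedness: the component in the block `k` of an element of the range is in the range
  have hmem : ∀ v : Fin m → BlockSum n ℂ →L[ℂ] ℂ, (∀ c, FinitelySupported (v c)) →
      (fun a r s => ∑ c, v c (T c a (matUnit n k r s))) ∈ Im := by
    intro v hv
    refine ⟨fun d => ∑ c, (v c).comp (q c d), fun d => ?_, fun a x => ?_⟩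
    · refine FinitelySupported.sum _ fun c => ?_
      obtain ⟨F, hF⟩ := hv c
      exact ⟨F, fun x hx => hF _ fun k hk => hq c d x k (hx k hk)⟩
    · have h1 : ∑ d, (∑ c, (v c).comp (q c d)) (T d a x) =
          ∑ c, v c (T c a (proj n ℂ k * x)) := by
        simp only [hT, map_sum, sum_apply, ContinuousLinearMap.comp_apply]
        exact Finset.sum_comm
      rw [h1, proj_mul_eq_sum]
      have h2 : ∀ c, v c (T c a (∑ r, ∑ s, x k r s • matUnit n k r s)) =
          ∑ r, ∑ s, v c (T c a (matUnit n k r s)) * x k r s := fun c => by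
        simp only [map_sum]
        refine Finset.sum_congr rfl fun r _ => Finset.sum_congr rfl fun s _ => ?_
        exact (((v c).toLinearMap ∘ₗ T c a).map_smul _ _).trans (mul_comm _ _)
      simp only [h2, Finset.sum_mul]
      exact Finset.sum_comm_cycle.symm
  -- testing `f` on the images of coefficient functionals shows that `y` is in the kernel of `T`
  have hy0 : y = 0 := by
    refine hinj y (fun a => ?_) fun c => ext_entry fun j r s => ?_
    · simp only [y, Finset.mul_sum, mul_smul_comm, proj_mul_matUnit]
    · let v : Fin m → BlockSum n ℂ →L[ℂ] ℂ := fun c' => if c' = c then entry n ℂ j r s else 0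
      have hv : ∀ c', FinitelySupported (v c') := fun c' => by
        by_cases h : c' = c
        · simp only [v, h, if_true]; exact finitelySupported_entry j r s
        · simp only [v, h, if_false]; exact ⟨∅, fun _ _ => rfl⟩
      have h1 := hf (hmem v hv)
      rw [LinearMap.mem_ker, hfW] at h1
      have h2 : ∀ a z, ∑ c', v c' (T c' a z) = entry n ℂ j r s (T c a z) := fun a z => by
        rw [Finset.sum_eq_single_of_mem c (Finset.mem_univ c) fun c' _ hc' => by
          simp only [v, hc', if_false]; rfl]
        simp only [v, if_true]
      have h3 : entry n ℂ j r s (∑ a, T c a (y a)) = 0 := by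
        rw [← h1, map_sum]
        refine Finset.sum_congr rfl fun a _ => ?_
        simp only [y, map_sum]
        refine Finset.sum_congr rfl fun r' _ => Finset.sum_congr rfl fun s' _ => ?_
        rw [h2 a (matUnit n k r' s')]
        exact (((entry n ℂ j r s).toLinearMap ∘ₗ T c a).map_smul _ _).trans (mul_comm _ _)
      exact h3
  refine hf0 (LinearMap.ext fun W => ?_)
  rw [hfW]
  refine Finset.sum_eq_zero fun a _ => Finset.sum_eq_zero fun r _ =>
    Finset.sum_eq_zero fun s _ => ?_
  have h1 : y a k r s = f (E a r s) := by
    simp only [y, sum_entry, smul_entry, matUnit_entry, smul_eq_mul, mul_ite, mul_one, mul_zero,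
      ite_and]
    simp
  rw [← h1, hy0]
  simp

end Preimage

/-! ### Finiteness of the components of the co-multiplication -/

namespace DiscreteQuantumGroup

variable (G : DiscreteQuantumGroup.{u})

open BlockSum

/-- The matrix coefficient `m ↦ Δ(m)` at `(i, a, b)` in the first and `(j, c, d)` in the second
leg. -/
def comulEntry (i : G.ι) (a b : Fin (G.dim i)) (j : G.ι) (c d : Fin (G.dim j)) :
    G.EllInf →ₗ[ℂ] ℂ :=
  (entry G.dim ℂ j c d).toLinearMap ∘ₗ (entry G.dim G.EllInf i a b).toLinearMap ∘ₗ
    G.comul.toLinearMap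

theorem comulEntry_apply (i : G.ι) (a b : Fin (G.dim i)) (j : G.ι) (c d : Fin (G.dim j))
    (x : G.EllInf) : G.comulEntry i a b j c d x = G.comul x i a b j c d := rfl

theorem comulEntry_mul (i : G.ι) (a b : Fin (G.dim i)) (j : G.ι) (c d : Fin (G.dim j))
    (x y : G.EllInf) : G.comulEntry i a b j c d (x * y) =
      ∑ e, ∑ f, G.comulEntry i a e j c f x * G.comulEntry i e b j f d y := by
  simp only [comulEntry_apply]
  rw [map_mul, mul_entry, sum_entry]
  exact Finset.sum_congr rfl fun e _ => mul_entry _ _ j c d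

theorem comulEntry_star (i : G.ι) (a b : Fin (G.dim i)) (j : G.ι) (c d : Fin (G.dim j))
    (x : G.EllInf) : G.comulEntry i a b j c d (star x) = star (G.comulEntry i b a j d c x) := by
  simp only [comulEntry_apply]
  rw [map_star]
  rfl

/-- The components `(π_i ⊗ π_j) Δ(p_k)` are mutually orthogonal idempotents in a matrix algebra, so
only finitely many of them are nonzero. -/
theorem exists_comulEntry_proj_eq_zero (i j : G.ι) : ∃ F : Finset G.ι, ∀ k ∉ F, ∀ a b c d,
    G.comulEntry i a b j c d (proj G.dim ℂ k) = 0 := by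
  classical
  let Ψ : G.EllInf →ₗ[ℂ] (Fin (G.dim i) → Fin (G.dim i) → Fin (G.dim j) → Fin (G.dim j) → ℂ) :=
    LinearMap.pi fun a => LinearMap.pi fun b => LinearMap.pi fun c => LinearMap.pi fun d =>
      G.comulEntry i a b j c d
  have hΨ : ∀ x a b c d, Ψ x a b c d = G.comulEntry i a b j c d x := fun _ _ _ _ _ => rfl
  have hli : LinearIndependent ℂ
      fun k : {k : G.ι // Ψ (proj G.dim ℂ k) ≠ 0} => Ψ (proj G.dim ℂ k.1) := by
    rw [linearIndependent_iff']
    intro s g hg l hl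
    have h1 : Ψ (∑ k ∈ s, g k • proj G.dim ℂ k.1) = 0 := by
      refine Eq.trans ?_ hg
      rw [map_sum]
      exact Finset.sum_congr rfl fun k _ => Ψ.map_smul _ _
    have h2 : (∑ k ∈ s, g k • proj G.dim ℂ k.1) * proj G.dim ℂ l.1 = g l • proj G.dim ℂ l.1 := by
      rw [Finset.sum_mul, Finset.sum_eq_single_of_mem l hl fun k _ hk => by
        rw [smul_mul_assoc, proj_mul_proj_ne fun h => hk (Subtype.ext h), smul_zero],
        smul_mul_assoc, proj_mul_proj]
    have h3 : g l • Ψ (proj G.dim ℂ l.1) = 0 := by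
      refine (Ψ.map_smul _ _).symm.trans ?_
      refine (congrArg Ψ h2.symm).trans ?_
      funext a b c d
      rw [hΨ, comulEntry_mul]
      refine Finset.sum_eq_zero fun e _ => Finset.sum_eq_zero fun f _ => ?_
      rw [← hΨ _ a e c f, h1]
      exact zero_mul _
    exact (smul_eq_zero.1 h3).resolve_right l.2
  have hfin : {k : G.ι | Ψ (proj G.dim ℂ k) ≠ 0}.Finite := Set.finite_coe_iff.1 hli.finite
  refine ⟨hfin.toFinset, fun k hk a b c d => ?_⟩
  rw [Set.Finite.mem_toFinset, Set.mem_ofPred_eq, not_not] at hk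
  rw [← hΨ, hk]
  rfl

/-- The central projection `p_i ⊗ p_j`. -/
def projTensor (i j : G.ι) : G.Tensor G.EllInf :=
  single i (CStarMatrix.ofMatrix (Matrix.diagonal fun _ => proj G.dim ℂ j))

theorem projTensor_entry (i j : G.ι) (a b : Fin (G.dim i)) :
    G.projTensor i j i a b = if a = b then proj G.dim ℂ j else 0 := by
  rw [projTensor, single_block_self]
  exact Matrix.diagonal_apply _ _ _

theorem projTensor_mul_entry (i j : G.ι) (X : G.Tensor G.EllInf) (a b : Fin (G.dim i)) :
    (G.projTensor i j * X) i a b = proj G.dim ℂ j * X i a b := by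
  rw [mul_entry]
  simp only [projTensor_entry]
  simp

theorem mul_projTensor_entry (i j : G.ι) (X : G.Tensor G.EllInf) (a b : Fin (G.dim i)) :
    (X * G.projTensor i j) i a b = X i a b * proj G.dim ℂ j := by
  rw [mul_entry]
  simp only [projTensor_entry]
  simp

theorem projTensor_mul_block_ne {i k : G.ι} (j : G.ι) (h : k ≠ i) (X : G.Tensor G.EllInf) :
    (G.projTensor i j * X) k = 0 := by
  rw [mul_block, projTensor, single_block_ne h, zero_mul]

theorem projTensor_comm (i j : G.ι) (X : G.Tensor G.EllInf) :
    G.projTensor i j * X = X * G.projTensor i j := by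
  refine ext fun k => ?_
  by_cases hk : k = i
  · subst hk
    refine CStarMatrix.ext fun a b => ?_
    rw [projTensor_mul_entry, mul_projTensor_entry, proj_comm]
  · rw [projTensor_mul_block_ne _ _ hk, mul_block, projTensor, single_block_ne hk, mul_zero]

theorem projTensor_mul_self (i j : G.ι) :
    G.projTensor i j * G.projTensor i j = G.projTensor i j := by
  refine ext fun k => ?_
  by_cases hk : k = i
  · subst hk
    refine CStarMatrix.ext fun a b => ?_
    rw [projTensor_mul_entry, projTensor_entry]
    split_ifs
    · exact proj_mul_proj j
    · exact mul_zero _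
  · rw [projTensor_mul_block_ne _ _ hk, projTensor, single_block_ne hk]

theorem star_projTensor (i j : G.ι) : star (G.projTensor i j) = G.projTensor i j := by
  refine ext fun k => ?_
  by_cases hk : k = i
  · subst hk
    refine CStarMatrix.ext fun a b => ?_
    rw [star_entry, projTensor_entry, projTensor_entry]
    simp only [eq_comm (a := b)]
    split_ifs
    · exact star_proj j
    · exact star_zero _
  · rw [star_block, projTensor, single_block_ne hk, star_zero]

theorem projTensor_mul_eq_zero_iff (i j : G.ι) (x : G.EllInf) :
    G.projTensor i j * G.comul x = 0 ↔ ∀ a b c d, G.comulEntry i a b j c d x = 0 := by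
  constructor
  · intro h a b c d
    have h1 : (G.projTensor i j * G.comul x) i a b j c d = 0 := by rw [h]; rfl
    rw [projTensor_mul_entry, proj_mul_block_self] at h1
    exact h1
  · intro h
    refine ext fun k => ?_
    by_cases hk : k = i
    · subst hk
      refine CStarMatrix.ext fun a b => ?_
      rw [projTensor_mul_entry]
      refine ext fun l => ?_
      by_cases hl : l = j
      · subst hl
        rw [proj_mul_block_self]
        exact CStarMatrix.ext fun c d => h a b c d
      · rw [proj_mul_block_ne hl]; rfl
    · exact G.projTensor_mul_block_ne _ hk _

/-- Each component `(π_i ⊗ π_j) Δ` of the co-multiplication factors through finitely many blocks.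
By normality of `Δ` the component vanishes at `1 - ∑_{k ∈ F} p_k`, if it does at all other `p_k`. -/
theorem exists_support_comulEntry (i j : G.ι) : ∃ F : Finset G.ι, ∀ x : G.EllInf,
    (∀ k ∈ F, x k = 0) → ∀ a b c d, G.comulEntry i a b j c d x = 0 := by
  classical
  obtain ⟨F, hF⟩ := G.exists_comulEntry_proj_eq_zero i j
  refine ⟨F, ?_⟩
  let q : G.EllInf := 1 - ∑ k ∈ F, proj G.dim ℂ k
  have hqb : ∀ k, q k = if k ∈ F then 0 else 1 := by
    intro k
    have h1 : (∑ l ∈ F, proj G.dim ℂ l) k = if k ∈ F then 1 else 0 := by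
      refine CStarMatrix.ext fun a b => ?_
      rw [sum_entry]
      split_ifs with hk
      · rw [Finset.sum_eq_single_of_mem k hk fun l _ hl => by
          rw [proj, single_block_ne hl.symm]; rfl, proj_block_self]
      · exact Finset.sum_eq_zero fun l hl => by
          rw [proj, single_block_ne (fun h : k = l => hk (h ▸ hl))]; rfl
    rw [sub_block, one_block, h1]
    split_ifs <;> simp
  have hq0 : 0 ≤ q := by
    rw [nonneg_iff]
    intro k
    rw [hqb]
    split_ifs
    · exact ⟨0, by simp⟩
    · exact ⟨1, by simp⟩
  have hpq : ∀ k, G.projTensor i j * G.comul (proj G.dim ℂ k * q) = 0 := by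
    intro k
    by_cases hk : k ∈ F
    · have : proj G.dim ℂ k * q = 0 := by
        refine ext fun l => ?_
        by_cases hl : l = k
        · subst hl; rw [proj_mul_block_self, hqb, if_pos hk]; rfl
        · rw [proj_mul_block_ne hl]; rfl
      rw [this, map_zero, mul_zero]
    · have : proj G.dim ℂ k * q = proj G.dim ℂ k := by
        refine ext fun l => ?_
        by_cases hl : l = k
        · subst hl; rw [proj_mul_block_self, hqb, if_neg hk, proj_block_self]
        · rw [proj_mul_block_ne hl, proj, single_block_ne hl]
      rw [this, projTensor_mul_eq_zero_iff]
      exact hF k hk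
  have hlub := G.comul_normal _ ⟨_, Set.mem_range_self ∅⟩ (directedOn_sum_proj_mul hq0)
    (by
      rintro _ ⟨S, rfl⟩
      exact .of_nonneg (Finset.sum_nonneg fun k _ => proj_mul_nonneg k hq0)) q
    (isLUB_sum_proj_mul hq0)
  set P := G.projTensor i j with hP
  have hPnn : ∀ X : G.Tensor G.EllInf, 0 ≤ X → 0 ≤ P * X := fun X hX =>
    mul_nonneg_of_central_idempotent (G.star_projTensor i j) (G.projTensor_mul_self i j)
      (G.projTensor_comm i j X) hX
  have hPnn' : ∀ X : G.Tensor G.EllInf, 0 ≤ X → 0 ≤ X - P * X := fun X hX => by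
    have := mul_nonneg_of_central_idempotent (p := 1 - P) (x := X)
      (by rw [star_sub, star_one, G.star_projTensor i j])
      (by rw [mul_sub, mul_one, sub_mul, one_mul, G.projTensor_mul_self i j, sub_self, sub_zero])
      (by rw [sub_mul, mul_sub, one_mul, mul_one, G.projTensor_comm i j X]) hX
    rwa [sub_mul, one_mul] at this
  -- removing the component from `Δ(q)` leaves an upper bound of the `Δ(∑_{k ∈ S} p_k q)`
  have hub : G.comul q ≤ G.comul q - P * G.comul q := hlub.2 <| by
    rintro _ ⟨_, ⟨S, rfl⟩, rfl⟩
    have h1 : P * G.comul (∑ k ∈ S, proj G.dim ℂ k * q) = 0 := by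
      rw [map_sum, Finset.mul_sum]
      exact Finset.sum_eq_zero fun k _ => hpq k
    have h2 := hPnn' _ (sub_nonneg.2 (hlub.1 ⟨_, ⟨S, rfl⟩, rfl⟩))
    rw [mul_sub, h1, sub_zero] at h2
    rw [← sub_nonneg]
    convert! h2 using 1
    abel
  have hcq0 : 0 ≤ G.comul q := map_nonneg G.comul hq0
  have hPq : P * G.comul q = 0 :=
    le_antisymm (by simpa using sub_nonneg.2 hub) (hPnn _ hcq0)
  intro x hx
  have hxq : x = q * x := by
    refine ext fun k => ?_
    rw [mul_block, hqb]
    split_ifs with hk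
    · rw [hx k hk, zero_mul]
    · rw [one_mul]
  rw [← projTensor_mul_eq_zero_iff, hxq, map_mul, ← mul_assoc, ← hP, hPq, zero_mul]

theorem finitelySupported_comulEntry (i : G.ι) (a b : Fin (G.dim i)) (j : G.ι)
    (c d : Fin (G.dim j)) : FinitelySupported (G.comulEntry i a b j c d) := by
  obtain ⟨F, hF⟩ := G.exists_support_comulEntry i j
  exact ⟨F, fun x hx => hF x hx a b c d⟩

/-- `θ ((Δ ⊗ id)(x)) = Δ ((id ⊗ θ)(x))`, entry by entry. -/
theorem apply_comulTensorIdEntry {N : Type v} [CStarAlgebra N] [PartialOrder N]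
    [StarOrderedRing N] (θ : N →L[ℂ] ℂ) (X : G.Tensor N) (i : G.ι)
    (a b : Fin (G.dim i)) (j : G.ι) (c d : Fin (G.dim j)) :
    θ (comulTensorIdEntry G.comul X i a b j c d) = G.comul (rightSlice θ X) i a b j c d :=
  apply_leftSlice (G.comulEntry i a b j c d) (G.finitelySupported_comulEntry i a b j c d) θ X

/-- `x ↦ (id ⊗ θ) Δ(x)`. -/
def slice (θ : G.EllInf →L[ℂ] ℂ) : G.EllInf →ₗ[ℂ] G.EllInf :=
  rightSlice θ ∘ₗ G.comul.toLinearMap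

theorem slice_apply (θ : G.EllInf →L[ℂ] ℂ) (x : G.EllInf) :
    G.slice θ x = rightSlice θ (G.comul x) := rfl

theorem slice_entry (θ : G.EllInf →L[ℂ] ℂ) (x : G.EllInf) (i : G.ι) (a b : Fin (G.dim i)) :
    G.slice θ x i a b = θ (G.comul x i a b) := rfl

/-- Co-associativity: right slicing commutes with the co-multiplication. -/
theorem slice_comul_entry (θ : G.EllInf →L[ℂ] ℂ) (x : G.EllInf) (i : G.ι)
    (a b : Fin (G.dim i)) : G.slice θ (G.comul x i a b) = G.comul (G.slice θ x) i a b := by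
  refine ext_entry fun j c d => ?_
  rw [slice_entry, ← G.coassoc, apply_comulTensorIdEntry, slice_apply]

end DiscreteQuantumGroup

/-! ### Convolution equations -/

section VectorFunctional

variable {ι : Type u} {n : ι → ℕ}

open BlockSum

/-- The vector functional `x ↦ ⟨ξ, x_i ξ⟩` on the `i`-th block. -/
def vectorFunctional (i : ι) (ξ : Fin (n i) → ℂ) : BlockSum n ℂ →L[ℂ] ℂ :=
  ∑ a, ∑ b, (star (ξ a) * ξ b) • entry n ℂ i a b

theorem vectorFunctional_apply (i : ι) (ξ : Fin (n i) → ℂ) (x : BlockSum n ℂ) :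
    vectorFunctional i ξ x = ∑ a, ∑ b, star (ξ a) * ξ b * x i a b := by
  simp only [vectorFunctional, sum_apply, smul_apply, entry_apply, smul_eq_mul]

theorem vectorFunctional_support (i : ι) (ξ : Fin (n i) → ℂ) (x : BlockSum n ℂ)
    (hx : ∀ k ∈ ({i} : Finset ι), x k = 0) : vectorFunctional i ξ x = 0 := by
  rw [vectorFunctional_apply, hx i (Finset.mem_singleton_self i)]
  simp

theorem leftSlice_vectorFunctional {N : Type v} [CStarAlgebra N] [PartialOrder N]
    [StarOrderedRing N] (i : ι) (ξ : Fin (n i) → ℂ) (X : BlockSum n N) :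
    leftSlice (vectorFunctional i ξ) X = ∑ a, ∑ b, (star (ξ a) * ξ b) • X i a b := by
  rw [leftSlice_eq_sum _ (vectorFunctional_support i ξ), Finset.sum_singleton]
  refine Finset.sum_congr rfl fun a _ => Finset.sum_congr rfl fun b _ => ?_
  rw [vectorFunctional_apply]
  simp only [matUnit_entry, mul_ite, mul_one, mul_zero, ite_and]
  simp

variable [∀ i, NeZero (n i)]

theorem vectorFunctional_one (i : ι) (ξ : Fin (n i) → ℂ) :
    ENNReal.ofReal (vectorFunctional i ξ 1).re = ENNReal.ofReal (∑ a, ‖ξ a‖ ^ 2) := by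
  have h : vectorFunctional i ξ 1 = ((∑ a, ‖ξ a‖ ^ 2 : ℝ) : ℂ) := by
    rw [vectorFunctional_apply]
    simp only [one_entry, mul_ite, mul_one, mul_zero, Finset.sum_ite_eq, Finset.mem_univ, if_true]
    rw [Complex.ofReal_sum]
    refine Finset.sum_congr rfl fun a _ => ?_
    rw [Complex.star_def, Complex.conj_mul']
    norm_cast
  rw [h, Complex.ofReal_re]

theorem isPositiveNormal_vectorFunctional (i : ι) (ξ : Fin (n i) → ℂ) :
    IsPositiveNormal (vectorFunctional i ξ) := by
  have hpos : ∀ x, 0 ≤ x → 0 ≤ vectorFunctional i ξ x := by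
    intro x hx
    obtain ⟨z, rfl⟩ := CStarAlgebra.nonneg_iff_eq_star_mul_self.1 hx
    have : vectorFunctional i ξ (star z * z) =
        ∑ c, star (∑ a, ξ a * z i c a) * ∑ b, ξ b * z i c b := by
      rw [vectorFunctional_apply]
      simp only [mul_entry, star_entry, star_sum, star_mul', Finset.sum_mul_sum]
      simp only [Finset.mul_sum]
      rw [Finset.sum_comm_cycle]
      refine Finset.sum_congr rfl fun c _ => Finset.sum_congr rfl fun a _ =>
        Finset.sum_congr rfl fun b _ => by ring
    rw [this]
    exact Finset.sum_nonneg fun c _ => star_mul_self_nonneg _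
  refine ⟨hpos, isNormalMap_of_block _ hpos i fun x => ?_⟩
  rw [vectorFunctional_apply, vectorFunctional_apply, proj_mul_block_self]

end VectorFunctional

namespace DiscreteQuantumGroup

variable (G : DiscreteQuantumGroup.{u})

open BlockSum

theorem slice_entry_mul (j : G.ι) (a b : Fin (G.dim j)) (x y : G.EllInf) :
    G.slice (entry G.dim ℂ j a b) (x * y) =
      ∑ c, G.slice (entry G.dim ℂ j a c) x * G.slice (entry G.dim ℂ j c b) y := by
  refine ext_entry fun l p q => ?_
  rw [sum_entry]
  simp only [mul_entry]
  rw [Finset.sum_comm]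
  exact G.comulEntry_mul l p q j a b x y

theorem slice_entry_star (j : G.ι) (a b : Fin (G.dim j)) (x : G.EllInf) :
    G.slice (entry G.dim ℂ j a b) (star x) = star (G.slice (entry G.dim ℂ j b a) x) :=
  ext_entry fun l p q => G.comulEntry_star l p q j a b x

theorem comul_star_entry (i : G.ι) (a b : Fin (G.dim i)) (x : G.EllInf) :
    G.comul (star x) i a b = star (G.comul x i b a) := by
  rw [map_star]; rfl

theorem comul_mul_entry (i : G.ι) (a b : Fin (G.dim i)) (x y : G.EllInf) :
    G.comul (x * y) i a b = ∑ c, G.comul x i a c * G.comul y i c b := by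
  rw [map_mul, mul_entry]

/-- Consequence of left invariance: with `u^i_{ab}` the matrix coefficients of the `i`-th block,
every tuple `w` of functionals on the `k`-th block is of the form `w_a = ∑_b u^i_{ab} * v_b` for the
convolution product. -/
theorem exists_left_convolution_eq (i k : G.ι)
    (w : Fin (G.dim i) → Fin (G.dim k) → Fin (G.dim k) → ℂ) :
    ∃ v : Fin (G.dim i) → G.EllInf →L[ℂ] ℂ, (∀ b, FinitelySupported (v b)) ∧
      ∀ a x, ∑ b, v b (G.comul x i a b) = ∑ r, ∑ s, w a r s * x k r s := by
  let π : Fin (G.dim i) → Fin (G.dim i) → G.EllInf →ₗ[ℂ] G.EllInf := fun a b =>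
    (entry G.dim G.EllInf i a b).toLinearMap ∘ₗ G.comul.toLinearMap
  have hπ : ∀ a b x, π a b x = G.comul x i a b := fun _ _ _ => rfl
  refine exists_sum_comp_eq (fun c a => π a c) k (fun y hy h0 => ?_)
    (fun c d => (ContinuousLinearMap.mul ℂ G.EllInf).flip (G.comul (proj G.dim ℂ k) i d c))
    (fun c d x l hx => ?_) (fun c a x => ?_) w
  · have h := G.leftHaar.eq_zero_of_invariant π (fun x y a b => ?_) (fun ξ x hx hfin => ?_) k
      (fun a => star (y a)) (fun a => ?_) fun c => ?_
    · funext a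
      exact star_eq_zero.1 (congrFun h a)
    · simp only [hπ, comul_mul_entry, comul_star_entry]
    · have := G.left_invariant _ (isPositiveNormal_vectorFunctional i ξ) x hx hfin
      rwa [leftSlice_vectorFunctional, vectorFunctional_one] at this
    · rw [proj_comm]
      nth_rw 1 [← star_proj]
      rw [← star_mul, hy]
    · simp only [hπ, comul_star_entry]
      rw [← star_sum]
      exact star_eq_zero.2 (h0 c)
  · change (x * _) l = 0
    rw [mul_block, hx, zero_mul]
  · rw [hπ, proj_comm, comul_mul_entry]
    rfl

/-- Consequence of right invariance: every tuple `w` of functionals on the `k`-th block is of the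
form `w_b = ∑_a v_a * u^j_{ab}` for the convolution product. -/
theorem exists_right_convolution_eq (j k : G.ι)
    (w : Fin (G.dim j) → Fin (G.dim k) → Fin (G.dim k) → ℂ) :
    ∃ v : Fin (G.dim j) → G.EllInf →L[ℂ] ℂ, (∀ a, FinitelySupported (v a)) ∧
      ∀ b x, ∑ a, v a (G.slice (entry G.dim ℂ j a b) x) = ∑ r, ∑ s, w b r s * x k r s := by
  refine exists_sum_comp_eq (fun c a => G.slice (entry G.dim ℂ j c a)) k (fun y hy h0 => ?_)
    (fun c d => ContinuousLinearMap.mul ℂ G.EllInf (G.slice (entry G.dim ℂ j c d) (proj G.dim ℂ k)))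
    (fun c d x l hx => ?_) (fun c a x => ?_) w
  · refine G.rightHaar.eq_zero_of_invariant _ (fun x y a b => ?_) (fun ξ x hx hfin => ?_) k
      y hy h0
    · simp only [slice_entry_mul, slice_entry_star]
    · have := G.right_invariant _ (isPositiveNormal_vectorFunctional j ξ) x hx hfin
      rw [vectorFunctional_one] at this
      rw [← this]
      congr 1
      refine ext_entry fun l p q => ?_
      rw [rightSlice_entry, vectorFunctional_apply]
      simp only [sum_entry]
      rfl
  · change (_ * x) l = 0
    rw [mul_block, hx, mul_zero]
  · rw [slice_entry_mul]
    rfl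

end DiscreteQuantumGroup

/-! ### The unit of the convolution algebra -/

namespace DiscreteQuantumGroup

variable (G : DiscreteQuantumGroup.{u})

open BlockSum

/-- If `θ = ∑_b u^i_{ab} * v_b`, then `id ⊗ θ` factors accordingly on the range of `Δ`, since
`ω ↦ (id ⊗ ω)Δ` turns convolution into composition. -/
theorem slice_eq_sum_of_convolution {i : G.ι} {a : Fin (G.dim i)} {θ : G.EllInf →L[ℂ] ℂ}
    {v : Fin (G.dim i) → G.EllInf →L[ℂ] ℂ} (h : ∀ x, ∑ b, v b (G.comul x i a b) = θ x)
    (x : G.EllInf) :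
    G.slice θ x = ∑ b, G.slice (entry G.dim ℂ i a b) (G.slice (v b) x) := by
  refine ext_entry fun l p q => ?_
  rw [slice_entry, ← h, sum_entry]
  refine Finset.sum_congr rfl fun b _ => ?_
  rw [slice_entry, ← slice_comul_entry]
  rfl

theorem slice_eq_sum_of_support (η : G.EllInf →L[ℂ] ℂ) {F : Finset G.ι}
    (hF : ∀ x, (∀ k ∈ F, x k = 0) → η x = 0) (x : G.EllInf) :
    G.slice η x =
      ∑ i ∈ F, ∑ a, ∑ b, η (matUnit G.dim i a b) • G.slice (entry G.dim ℂ i a b) x := by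
  refine ext_entry fun l p q => ?_
  rw [slice_entry]
  refine (apply_eq_sum_of_support η.toLinearMap hF _).trans ?_
  simp only [sum_entry]
  rfl

/-- The convolution algebra of finitely supported functionals has a right unit: solve
`u_{a b₀} = ∑_b u_{ab} * e_b`, and write an arbitrary coefficient as the `b₀`-th component of
`∑_a v_a * u_{ab}` to see that it is fixed by right convolution with `e_{b₀}`. -/
theorem exists_right_unit : ∃ e : G.EllInf →L[ℂ] ℂ, FinitelySupported e ∧ ∀ x, G.slice e x = x := by
  classical
  obtain ⟨i⟩ := G.nonempty
  let b₀ : Fin (G.dim i) := 0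
  obtain ⟨e, he, hue⟩ := G.exists_left_convolution_eq i i
    fun a r s => if r = a then if s = b₀ then 1 else 0 else 0
  refine ⟨e b₀, he b₀, fun x => ext_entry fun k p q => ?_⟩
  obtain ⟨v, -, hv⟩ := G.exists_right_convolution_eq i k
    fun b r s => if r = p then if s = q then if b = b₀ then 1 else 0 else 0 else 0
  have hue' : ∀ a x, ∑ b, e b (G.comul x i a b) = entry G.dim ℂ i a b₀ x := fun a x => by
    rw [hue]; simp
  have hv' : ∀ b x, ∑ a, v a (G.slice (entry G.dim ℂ i a b) x) =
      if b = b₀ then x k p q else 0 := fun b x => by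
    rw [hv]; simp
  calc G.slice (e b₀) x k p q
      = ∑ b, if b = b₀ then G.slice (e b) x k p q else 0 := by simp
    _ = ∑ b, ∑ a, v a (G.slice (entry G.dim ℂ i a b) (G.slice (e b) x)) := by simp only [hv']
    _ = ∑ a, v a (G.slice (entry G.dim ℂ i a b₀) x) := by
        rw [Finset.sum_comm]
        refine Finset.sum_congr rfl fun a _ => ?_
        rw [← map_sum, ← G.slice_eq_sum_of_convolution (hue' a)]
    _ = x k p q := by rw [hv', if_pos rfl]

/-- The convolution algebra of finitely supported functionals has a left unit, by the mirror image
of the argument for the right unit. -/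
theorem exists_left_unit : ∃ f : G.EllInf →L[ℂ] ℂ,
    ∀ k p q x, f (G.slice (entry G.dim ℂ k p q) x) = x k p q := by
  classical
  obtain ⟨i⟩ := G.nonempty
  let a₀ : Fin (G.dim i) := 0
  obtain ⟨f, -, hfu⟩ := G.exists_right_convolution_eq i i
    fun b r s => if r = a₀ then if s = b then 1 else 0 else 0
  refine ⟨f a₀, fun k p q x => ?_⟩
  obtain ⟨v, -, hv⟩ := G.exists_left_convolution_eq i k
    fun a r s => if r = p then if s = q then if a = a₀ then 1 else 0 else 0 else 0
  have hfu' : ∀ b x, ∑ a, f a (G.slice (entry G.dim ℂ i a b) x) = x i a₀ b := fun b x => by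
    rw [hfu]; simp
  have hv' : ∀ a x, ∑ b, v b (G.comul x i a b) =
      (if a = a₀ then entry G.dim ℂ k p q else 0) x := fun a x => by
    rw [hv]; split_ifs <;> simp
  have h0 : G.slice 0 x = 0 := rfl
  calc f a₀ (G.slice (entry G.dim ℂ k p q) x)
      = ∑ a, f a (G.slice (if a = a₀ then entry G.dim ℂ k p q else 0) x) := by
        rw [Finset.sum_eq_single_of_mem a₀ (Finset.mem_univ _) fun a _ ha => by
          rw [if_neg ha, h0, map_zero], if_pos rfl]
    _ = ∑ a, ∑ b, f a (G.slice (entry G.dim ℂ i a b) (G.slice (v b) x)) := by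
        refine Finset.sum_congr rfl fun a _ => ?_
        rw [G.slice_eq_sum_of_convolution (hv' a), map_sum]
    _ = ∑ b, v b (G.comul x i a₀ b) := by
        rw [Finset.sum_comm]
        exact Finset.sum_congr rfl fun b _ => hfu' b _
    _ = x k p q := by rw [hv', if_pos rfl]; rfl

theorem apply_slice_of_left_unit {f : G.EllInf →L[ℂ] ℂ}
    (hf : ∀ k p q x, f (G.slice (entry G.dim ℂ k p q) x) = x k p q)
    {η : G.EllInf →L[ℂ] ℂ} (hη : FinitelySupported η) (x : G.EllInf) :
    f (G.slice η x) = η x := by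
  obtain ⟨F, hF⟩ := hη
  rw [G.slice_eq_sum_of_support η hF]
  refine Eq.trans ?_ (apply_eq_sum_of_support η.toLinearMap hF x).symm
  simp only [map_sum, map_smul, hf]
  rfl

/-- The convolution algebra of finitely supported functionals has a unit. -/
theorem exists_unit : ∃ ε : G.EllInf →L[ℂ] ℂ, FinitelySupported ε ∧ (∀ x, G.slice ε x = x) ∧
    ∀ k p q x, ε (G.slice (entry G.dim ℂ k p q) x) = x k p q := by
  obtain ⟨e, he, hR⟩ := G.exists_right_unit
  obtain ⟨f, hf⟩ := G.exists_left_unit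
  have : f = e := ContinuousLinearMap.ext fun x => by
    rw [← G.apply_slice_of_left_unit hf he, hR]
  exact ⟨e, he, hR, this ▸ hf⟩

section Unit

variable {G} {ε : G.EllInf →L[ℂ] ℂ}

theorem unit_map_one (hR : ∀ x, G.slice ε x = x) : ε 1 = 1 := by
  obtain ⟨i⟩ := G.nonempty
  have h : G.slice ε 1 i 0 0 = (1 : G.EllInf) i 0 0 := by rw [hR]
  rw [slice_entry, map_one, one_entry, one_entry, if_pos rfl, if_pos rfl] at h
  exact h

/-- The functional `x ↦ conj (ε (x⋆))` is a right unit as well, so it agrees with `ε`. -/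
theorem unit_map_star (hR : ∀ x, G.slice ε x = x)
    (hL : ∀ k p q x, ε (G.slice (entry G.dim ℂ k p q) x) = x k p q)
    (hε : FinitelySupported ε) (x : G.EllInf) : ε (star x) = star (ε x) := by
  let ε' : G.EllInf →L[ℂ] ℂ := LinearMap.mkContinuous
    { toFun := fun x => star (ε (star x))
      map_add' := fun x y => by rw [star_add, map_add, star_add]
      map_smul' := fun c x => by
        rw [star_smul]
        refine (congrArg star (ε.map_smul _ _)).trans ?_
        rw [smul_eq_mul, star_mul', star_star]
        rfl } ‖ε‖ fun x => by
      rw [← norm_star x, LinearMap.coe_mk, AddHom.coe_mk, norm_star (ε _)]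
      exact ε.le_opNorm _
  have hε' : ∀ x, ε' x = star (ε (star x)) := fun _ => rfl
  have hfs : FinitelySupported ε' := by
    obtain ⟨F, hF⟩ := hε
    refine ⟨F, fun x hx => ?_⟩
    rw [hε', hF _ fun k hk => by rw [star_block, hx k hk, star_zero], star_zero]
  have hR' : ∀ x, G.slice ε' x = x := fun x => ext_entry fun l p q => by
    rw [slice_entry, hε', ← comul_star_entry, ← slice_entry, hR, star_entry, star_star]
  have h : ∀ x, ε x = ε' x := fun x => by
    rw [← G.apply_slice_of_left_unit hL hfs, hR']
  rw [h x, hε', star_star]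

/-- The bialgebra argument for multiplicativity: writing `δ_{cd} u^k_{pq} = ∑_b u^i_{cb} * v_b`, the
product of slices becomes a sum of slices of products, to which the unit property applies. -/
theorem unit_map_slice_mul_slice
    (hL : ∀ k p q x, ε (G.slice (entry G.dim ℂ k p q) x) = x k p q)
    (i : G.ι) (a d : Fin (G.dim i)) (k : G.ι) (p q : Fin (G.dim k))
    (x y : G.EllInf) :
    ε (G.slice (entry G.dim ℂ i a d) x * G.slice (entry G.dim ℂ k p q) y) =
      x i a d * y k p q := by
  classical
  obtain ⟨v, -, hv⟩ := G.exists_left_convolution_eq i k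
    fun c r s => if r = p then if s = q then if c = d then 1 else 0 else 0 else 0
  have hv' : ∀ c x, ∑ b, v b (G.comul x i c b) =
      (if c = d then entry G.dim ℂ k p q else 0) x := fun a x => by
    rw [hv]; split_ifs <;> simp
  have h0 : G.slice 0 y = 0 := rfl
  have h1 : G.slice (entry G.dim ℂ i a d) x * G.slice (entry G.dim ℂ k p q) y =
      ∑ b, G.slice (entry G.dim ℂ i a b) (x * G.slice (v b) y) := by
    calc G.slice (entry G.dim ℂ i a d) x * G.slice (entry G.dim ℂ k p q) y
        = ∑ c, G.slice (entry G.dim ℂ i a c) x *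
            G.slice (if c = d then entry G.dim ℂ k p q else 0) y := by
          rw [Finset.sum_eq_single_of_mem d (Finset.mem_univ _) fun c _ hc => by
            rw [if_neg hc, h0, mul_zero], if_pos rfl]
      _ = ∑ c, ∑ b, G.slice (entry G.dim ℂ i a c) x *
            G.slice (entry G.dim ℂ i c b) (G.slice (v b) y) := by
          refine Finset.sum_congr rfl fun c _ => ?_
          rw [G.slice_eq_sum_of_convolution (hv' c), Finset.mul_sum]
      _ = _ := by
          rw [Finset.sum_comm]
          exact Finset.sum_congr rfl fun b _ => (G.slice_entry_mul i a b _ _).symm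
  rw [h1, map_sum]
  simp only [hL, mul_entry]
  rw [Finset.sum_comm]
  simp only [← Finset.mul_sum, slice_entry, hv']
  rw [Finset.sum_eq_single_of_mem d (Finset.mem_univ _) fun c _ hc => by
    rw [if_neg hc, zero_apply, mul_zero], if_pos rfl, entry_apply]

theorem unit_map_mul (hR : ∀ x, G.slice ε x = x)
    (hL : ∀ k p q x, ε (G.slice (entry G.dim ℂ k p q) x) = x k p q)
    (hε : FinitelySupported ε) (x y : G.EllInf) : ε (x * y) = ε x * ε y := by
  have h1 : ∀ (i : G.ι) (a b : Fin (G.dim i)) (z : G.EllInf),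
      ε (G.slice (entry G.dim ℂ i a b) z * y) = z i a b * ε y := by
    intro i a b z
    obtain ⟨F, hF⟩ := hε
    conv_lhs => rw [← hR y, G.slice_eq_sum_of_support ε hF y]
    have hs : ε y = ∑ i ∈ F, ∑ a, ∑ b, ε (matUnit G.dim i a b) * y i a b :=
      apply_eq_sum_of_support ε.toLinearMap hF y
    rw [hs]
    simp only [Finset.mul_sum, mul_smul_comm, map_sum]
    refine Finset.sum_congr rfl fun k _ => Finset.sum_congr rfl fun p _ =>
      Finset.sum_congr rfl fun q _ => ?_
    refine (ε.map_smul _ _).trans ?_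
    rw [unit_map_slice_mul_slice hL, smul_eq_mul, mul_left_comm]
  obtain ⟨F, hF⟩ := hε
  conv_lhs => rw [← hR x, G.slice_eq_sum_of_support ε hF x]
  have hs : ε x = ∑ i ∈ F, ∑ a, ∑ b, ε (matUnit G.dim i a b) * x i a b :=
    apply_eq_sum_of_support ε.toLinearMap hF x
  rw [hs]
  simp only [Finset.sum_mul, smul_mul_assoc, map_sum]
  refine Finset.sum_congr rfl fun k _ => Finset.sum_congr rfl fun p _ =>
    Finset.sum_congr rfl fun q _ => ?_
  refine (ε.map_smul _ _).trans ?_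
  rw [h1, smul_eq_mul, mul_assoc]

end Unit

end DiscreteQuantumGroup

/-! ### Amplification of the co-multiplication -/

section Amplification

variable {ι : Type u} {n : ι → ℕ} {N : Type v} [CStarAlgebra N]

open BlockSum

/-- The elementary tensor `m ⊗ z`, as a (not necessarily bounded) family of matrices over `N`. -/
def elemTensor (m : BlockSum n ℂ) (z : N) : ∀ k, Matrix (Fin (n k)) (Fin (n k)) N :=
  fun k => Matrix.of fun a b => m k a b • z

theorem elemTensor_mul (m m' : BlockSum n ℂ) (z z' : N) :
    elemTensor m z * elemTensor m' z' = elemTensor (m * m') (z * z') := by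
  funext k
  ext a b
  simp only [Pi.mul_apply, Matrix.mul_apply, elemTensor, Matrix.of_apply, mul_entry,
    smul_mul_smul_comm, Finset.sum_smul]

/-- The finite sum `(ω ⊗ id)(X)`, for a family `X` of matrices over `N` and a functional `ω`
supported on the blocks in `F`. -/
def finiteSlice (F : Finset ι) (ω : BlockSum n ℂ →ₗ[ℂ] ℂ)
    (X : ∀ k, Matrix (Fin (n k)) (Fin (n k)) N) : N :=
  ∑ k ∈ F, ∑ a, ∑ b, ω (matUnit n k a b) • X k a b

theorem finiteSlice_add (F : Finset ι) (ω : BlockSum n ℂ →ₗ[ℂ] ℂ)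
    (X Y : ∀ k, Matrix (Fin (n k)) (Fin (n k)) N) :
    finiteSlice F ω (X + Y) = finiteSlice F ω X + finiteSlice F ω Y := by
  simp only [finiteSlice, Pi.add_apply, Matrix.add_apply, smul_add, Finset.sum_add_distrib]

theorem finiteSlice_zero (F : Finset ι) (ω : BlockSum n ℂ →ₗ[ℂ] ℂ) :
    finiteSlice F ω (0 : ∀ k, Matrix (Fin (n k)) (Fin (n k)) N) = 0 := by
  simp [finiteSlice]

theorem finiteSlice_congr {F : Finset ι} (ω : BlockSum n ℂ →ₗ[ℂ] ℂ)
    {X Y : ∀ k, Matrix (Fin (n k)) (Fin (n k)) N} (h : ∀ k ∈ F, X k = Y k) :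
    finiteSlice F ω X = finiteSlice F ω Y :=
  Finset.sum_congr rfl fun k hk => by rw [h k hk]

theorem finiteSlice_elemTensor {F : Finset ι} (ω : BlockSum n ℂ →ₗ[ℂ] ℂ)
    (hF : ∀ x, (∀ k ∈ F, x k = 0) → ω x = 0) (m : BlockSum n ℂ) (z : N) :
    finiteSlice F ω (elemTensor m z) = ω m • z := by
  rw [apply_eq_sum_of_support ω hF]
  simp only [finiteSlice, elemTensor, Matrix.of_apply, smul_smul, Finset.sum_smul]

theorem sum_elemTensor (F : Finset ι) (X : ∀ k, Matrix (Fin (n k)) (Fin (n k)) N) (k : ι)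
    (hk : k ∈ F) :
    (∑ i ∈ F, ∑ a, ∑ b, elemTensor (matUnit n i a b) (X i a b)) k = X k := by
  ext c d
  simp only [Finset.sum_apply, Matrix.sum_apply, elemTensor, Matrix.of_apply]
  rw [Finset.sum_eq_single_of_mem k hk fun i _ hik => ?_]
  · simp only [matUnit_entry, ite_and, ite_smul, one_smul, zero_smul]
    simp
  · simp [matUnit_block_ne hik.symm]

/-- A comultiplication-type identity `ω(m m') = ∑ ω₁(m) ω₂(m')` for functionals on the block sum
carries over to slices of families of matrices over `N`, by checking it on elementary tensors. -/
theorem finiteSlice_mul {κ : Type*} [Fintype κ] {F : Finset ι} {ω : BlockSum n ℂ →ₗ[ℂ] ℂ}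
    {ω₁ ω₂ : κ → BlockSum n ℂ →ₗ[ℂ] ℂ} (hF : ∀ x, (∀ k ∈ F, x k = 0) → ω x = 0)
    (hF₁ : ∀ t x, (∀ k ∈ F, x k = 0) → ω₁ t x = 0)
    (hF₂ : ∀ t x, (∀ k ∈ F, x k = 0) → ω₂ t x = 0)
    (h : ∀ x y, ω (x * y) = ∑ t, ω₁ t x * ω₂ t y)
    (X Y : ∀ k, Matrix (Fin (n k)) (Fin (n k)) N) :
    finiteSlice F ω (X * Y) = ∑ t, finiteSlice F (ω₁ t) X * finiteSlice F (ω₂ t) Y := by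
  let Q : (∀ k, Matrix (Fin (n k)) (Fin (n k)) N) → (∀ k, Matrix (Fin (n k)) (Fin (n k)) N) →
    Prop := fun X Y =>
      finiteSlice F ω (X * Y) = ∑ t, finiteSlice F (ω₁ t) X * finiteSlice F (ω₂ t) Y
  have hQl : ∀ X X' Y, Q X Y → Q X' Y → Q (X + X') Y := fun X X' Y h h' => by
    simp only [Q] at *
    simp only [add_mul, finiteSlice_add, h, h', Finset.sum_add_distrib]
  have hQr : ∀ X Y Y', Q X Y → Q X Y' → Q X (Y + Y') := fun X Y Y' h h' => by
    simp only [Q] at *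
    simp only [mul_add, finiteSlice_add, h, h', Finset.sum_add_distrib]
  have hQ0l : ∀ Y, Q 0 Y := fun Y => by simp [Q, finiteSlice_zero]
  have hQ0r : ∀ X, Q X 0 := fun Y => by simp [Q, finiteSlice_zero]
  have hQt : ∀ m z m' z', Q (elemTensor m z) (elemTensor m' z') := fun m z m' z' => by
    simp only [Q]
    rw [elemTensor_mul, finiteSlice_elemTensor ω hF, h, Finset.sum_smul]
    refine Finset.sum_congr rfl fun t _ => ?_
    rw [finiteSlice_elemTensor _ (hF₁ t), finiteSlice_elemTensor _ (hF₂ t), smul_mul_smul_comm]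
  have hQY : ∀ m z, Q (elemTensor m z)
      (∑ i ∈ F, ∑ a, ∑ b, elemTensor (matUnit n i a b) (Y i a b)) := fun m z =>
    Finset.sum_induction _ (Q _) (hQr _) (hQ0r _) fun k _ =>
      Finset.sum_induction _ (Q _) (hQr _) (hQ0r _) fun a _ =>
        Finset.sum_induction _ (Q _) (hQr _) (hQ0r _) fun b _ => hQt _ _ _ _
  have hQXY : Q (∑ i ∈ F, ∑ a, ∑ b, elemTensor (matUnit n i a b) (X i a b))
      (∑ i ∈ F, ∑ a, ∑ b, elemTensor (matUnit n i a b) (Y i a b)) :=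
    Finset.sum_induction _ (Q · _) (hQl · · _) (hQ0l _) fun k _ =>
      Finset.sum_induction _ (Q · _) (hQl · · _) (hQ0l _) fun a _ =>
        Finset.sum_induction _ (Q · _) (hQl · · _) (hQ0l _) fun b _ => hQY _ _
  have hX := sum_elemTensor F X
  have hY := sum_elemTensor F Y
  rw [finiteSlice_congr ω fun k hk => by
    rw [Pi.mul_apply, ← hX k hk, ← hY k hk, ← Pi.mul_apply]]
  simp only [Q] at hQXY
  rw [hQXY]
  refine Finset.sum_congr rfl fun t _ => ?_
  rw [finiteSlice_congr _ hX, finiteSlice_congr _ hY]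

theorem norm_apply_entry_le {B A : Type*} [NonUnitalCStarAlgebra B] [NonUnitalCStarAlgebra A]
    [PartialOrder A] [StarOrderedRing A] {m : ℕ} (Φ : B →⋆ₙₐ[ℂ] CStarMatrix (Fin m) (Fin m) A)
    (x : B) (a b : Fin m) : ‖Φ x a b‖ ≤ ‖x‖ :=
  (CStarMatrix.norm_entry_le_norm (M := Φ x)).trans (NonUnitalStarAlgHom.norm_apply_le Φ x)

end Amplification

namespace DiscreteQuantumGroup

variable (G : DiscreteQuantumGroup.{u}) {N : Type v} [CStarAlgebra N] [PartialOrder N]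
  [StarOrderedRing N]

open BlockSum

theorem comulTensorIdEntry_add (x y : G.Tensor N) (i : G.ι) (a b : Fin (G.dim i)) (j : G.ι)
    (c d : Fin (G.dim j)) : comulTensorIdEntry G.comul (x + y) i a b j c d =
      comulTensorIdEntry G.comul x i a b j c d + comulTensorIdEntry G.comul y i a b j c d := by
  obtain ⟨F, hF⟩ := G.finitelySupported_comulEntry i a b j c d
  have h := fun z : G.Tensor N => leftSlice_eq_sum (G.comulEntry i a b j c d) hF z
  refine (h _).trans ?_
  refine Eq.trans ?_ (congrArg₂ (· + ·) (h x) (h y)).symm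
  simp only [add_block, CStarMatrix.add_apply, smul_add, Finset.sum_add_distrib]

theorem comulTensorIdEntry_smul (t : ℂ) (x : G.Tensor N) (i : G.ι) (a b : Fin (G.dim i)) (j : G.ι)
    (c d : Fin (G.dim j)) : comulTensorIdEntry G.comul (t • x) i a b j c d =
      t • comulTensorIdEntry G.comul x i a b j c d := by
  obtain ⟨F, hF⟩ := G.finitelySupported_comulEntry i a b j c d
  have h := fun z : G.Tensor N => leftSlice_eq_sum (G.comulEntry i a b j c d) hF z
  refine (h _).trans ?_
  refine Eq.trans ?_ (congrArg (t • ·) (h x)).symm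
  simp only [smul_entry, Finset.smul_sum, smul_comm t]

theorem comulTensorIdEntry_star (x : G.Tensor N) (i : G.ι) (a b : Fin (G.dim i)) (j : G.ι)
    (c d : Fin (G.dim j)) : comulTensorIdEntry G.comul (star x) i a b j c d =
      star (comulTensorIdEntry G.comul x i b a j d c) := by
  obtain ⟨F, hF⟩ := G.exists_support_comulEntry i j
  have h := fun (z : G.Tensor N) a b c d =>
    leftSlice_eq_sum (G.comulEntry i a b j c d) (fun x hx => hF x hx a b c d) z
  refine (h _ a b c d).trans ?_
  refine Eq.trans ?_ (congrArg star (h x b a d c)).symm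
  simp only [star_sum, star_smul]
  refine Finset.sum_congr rfl fun k _ => ?_
  rw [Finset.sum_comm]
  refine Finset.sum_congr rfl fun p _ => Finset.sum_congr rfl fun q _ => ?_
  rw [star_entry, ← comulEntry_star]
  have : star (matUnit G.dim k p q) = matUnit G.dim k q p := by
    refine ext fun l => ?_
    by_cases hl : l = k
    · subst hl
      refine CStarMatrix.ext fun r s => ?_
      rw [star_entry, matUnit_entry, matUnit_entry]
      simp only [and_comm]
      split_ifs <;> simp
    · rw [star_block, matUnit_block_ne hl, matUnit_block_ne hl, star_zero]
  rw [this]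

theorem comulTensorIdEntry_mul (x y : G.Tensor N) (i : G.ι) (a b : Fin (G.dim i)) (j : G.ι)
    (c d : Fin (G.dim j)) : comulTensorIdEntry G.comul (x * y) i a b j c d =
      ∑ e, ∑ f, comulTensorIdEntry G.comul x i a e j c f *
        comulTensorIdEntry G.comul y i e b j f d := by
  obtain ⟨F, hF⟩ := G.exists_support_comulEntry i j
  have h : ∀ (z : G.Tensor N) a b c d, comulTensorIdEntry G.comul z i a b j c d =
      finiteSlice F (G.comulEntry i a b j c d) fun k => (z k : Matrix _ _ N) := fun z a b c d =>
    leftSlice_eq_sum (G.comulEntry i a b j c d) (fun x hx => hF x hx a b c d) z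
  simp only [h]
  rw [← Fintype.sum_prod_type']
  exact finiteSlice_mul (κ := Fin (G.dim i) × Fin (G.dim j))
    (ω₁ := fun t => G.comulEntry i a t.1 j c t.2) (ω₂ := fun t => G.comulEntry i t.1 b j t.2 d)
    (fun x hx => hF x hx _ _ _ _) (fun t x hx => hF x hx _ _ _ _) (fun t x hx => hF x hx _ _ _ _)
    (fun x y => by rw [comulEntry_mul, Fintype.sum_prod_type]) _ _

/-- The block of `(Δ ⊗ id)(x)` at `(i, a, b)` in the first leg and `j` in the second leg. -/
def comulTensorIdBlock (x : G.Tensor N) (i : G.ι) (a b : Fin (G.dim i)) (j : G.ι) :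
    CStarMatrix (Fin (G.dim j)) (Fin (G.dim j)) N :=
  CStarMatrix.ofMatrix (Matrix.of fun c d => comulTensorIdEntry G.comul x i a b j c d)

/-- The component `x ↦ (π_i ⊗ π_j ⊗ id)(Δ ⊗ id)(x)` is a ⋆-homomorphism between C⋆-algebras, hence
contractive. -/
theorem norm_comulTensorIdBlock_le (x : G.Tensor N) (i : G.ι) (a b : Fin (G.dim i)) (j : G.ι) :
    ‖G.comulTensorIdBlock x i a b j‖ ≤ ‖x‖ := by
  let : PartialOrder (CStarMatrix (Fin (G.dim j)) (Fin (G.dim j)) N) :=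
    CStarAlgebra.spectralOrder _
  have : StarOrderedRing (CStarMatrix (Fin (G.dim j)) (Fin (G.dim j)) N) :=
    CStarAlgebra.spectralOrderedRing _
  let Φ : G.Tensor N →⋆ₙₐ[ℂ] CStarMatrix (Fin (G.dim i)) (Fin (G.dim i))
      (CStarMatrix (Fin (G.dim j)) (Fin (G.dim j)) N) :=
    { toFun := fun x => CStarMatrix.ofMatrix (Matrix.of fun a b => G.comulTensorIdBlock x i a b j)
      map_smul' := fun t x => CStarMatrix.ext fun a b => CStarMatrix.ext fun c d =>
        G.comulTensorIdEntry_smul t x i a b j c d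
      map_zero' := CStarMatrix.ext fun a b => CStarMatrix.ext fun c d => by
        have := G.comulTensorIdEntry_smul (N := N) 0 0 i a b j c d
        rw [zero_smul, zero_smul] at this
        exact this
      map_add' := fun x y => CStarMatrix.ext fun a b => CStarMatrix.ext fun c d =>
        G.comulTensorIdEntry_add x y i a b j c d
      map_mul' := fun x y => CStarMatrix.ext fun a b => CStarMatrix.ext fun c d => by
        refine (G.comulTensorIdEntry_mul x y i a b j c d).trans ?_
        rw [CStarMatrix.mul_apply]
        have hs : ∀ Z : Fin (G.dim i) → CStarMatrix (Fin (G.dim j)) (Fin (G.dim j)) N,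
            (∑ e, Z e) c d = ∑ e, Z e c d := fun Z => Matrix.sum_apply c d _ Z
        rw [hs]
        exact Finset.sum_congr rfl fun e _ => CStarMatrix.mul_apply.symm
      map_star' := fun x => CStarMatrix.ext fun a b => CStarMatrix.ext fun c d =>
        G.comulTensorIdEntry_star x i a b j c d }
  exact norm_apply_entry_le Φ x a b

/-- The slice of `(Δ ⊗ id)(x)` at `(i, a, b)` in the first leg. -/
def comulTensorIdSlice (x : G.Tensor N) (i : G.ι) (a b : Fin (G.dim i)) : G.Tensor N :=
  BlockSum.mk (fun j => G.comulTensorIdBlock x i a b j) ‖x‖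
    fun j => G.norm_comulTensorIdBlock_le x i a b j

/-- The component of `Δ ⊗ id` at the block `i` of the first leg is contractive, for the same reason;
this bounds the norm of a matrix over `ℓ^∞(𝔾) ⊗̄ N` without computing it. -/
theorem norm_comulTensorIdSlice_le (x : G.Tensor N) (i : G.ι) :
    ‖(CStarMatrix.ofMatrix (Matrix.of fun a b => G.comulTensorIdSlice x i a b) :
      CStarMatrix (Fin (G.dim i)) (Fin (G.dim i)) (G.Tensor N))‖ ≤ ‖x‖ := by
  let Φ : G.Tensor N →⋆ₙₐ[ℂ] CStarMatrix (Fin (G.dim i)) (Fin (G.dim i)) (G.Tensor N) :=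
    { toFun := fun x => CStarMatrix.ofMatrix (Matrix.of fun a b => G.comulTensorIdSlice x i a b)
      map_smul' := fun t x => CStarMatrix.ext fun a b => ext_entry fun j c d =>
        G.comulTensorIdEntry_smul t x i a b j c d
      map_zero' := CStarMatrix.ext fun a b => ext_entry fun j c d => by
        have := G.comulTensorIdEntry_smul (N := N) 0 0 i a b j c d
        rw [zero_smul, zero_smul] at this
        exact this
      map_add' := fun x y => CStarMatrix.ext fun a b => ext_entry fun j c d =>
        G.comulTensorIdEntry_add x y i a b j c d
      map_mul' := fun x y => CStarMatrix.ext fun a b => ext_entry fun j c d => by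
        refine (G.comulTensorIdEntry_mul x y i a b j c d).trans ?_
        rw [CStarMatrix.mul_apply, sum_entry]
        exact Finset.sum_congr rfl fun e _ =>
          (mul_entry (G.comulTensorIdSlice x i a e) (G.comulTensorIdSlice y i e b) j c d).symm
      map_star' := fun x => CStarMatrix.ext fun a b => ext_entry fun j c d =>
        G.comulTensorIdEntry_star x i a b j c d }
  exact NonUnitalStarAlgHom.norm_apply_le Φ x

/-- `(Δ ⊗ id)(x)`, as an element of `ℓ^∞(𝔾) ⊗̄ ℓ^∞(𝔾) ⊗̄ N`. -/
def comulTensorId [Nontrivial N] (x : G.Tensor N) : G.Tensor (G.Tensor N) :=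
  BlockSum.mk
    (fun i => CStarMatrix.ofMatrix (Matrix.of fun a b => G.comulTensorIdSlice x i a b)) ‖x‖
    fun i => G.norm_comulTensorIdSlice_le x i

/-! ### The co-unit and the conditional expectation -/

section Counit

variable {G} {ε : G.EllInf →L[ℂ] ℂ}

/-- Equivariance only uses co-associativity, so it holds for any bounded functional `ε`. -/
theorem isEquivariant_comul_comp_rightSlice (ε : G.EllInf →L[ℂ] ℂ) :
    G.IsEquivariant (G.comul.toLinearMap ∘ₗ rightSlice ε) := by
  refine fun x => ⟨G.comulTensorId x, fun i a b j c d => rfl, fun i a b j c d => ?_⟩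
  have h : rightSlice ε (G.comulTensorId x i a b) = G.comul (rightSlice ε x) i a b :=
    ext_entry fun j c d => G.apply_comulTensorIdEntry ε x i a b j c d
  change G.comul (rightSlice ε (G.comulTensorId x i a b)) j c d =
    comulTensorIdEntry G.comul (G.comul (rightSlice ε x)) i a b j c d
  rw [h, G.coassoc]

theorem rightSlice_mul (hmul : ∀ x y, ε (x * y) = ε x * ε y) (x y : G.Tensor G.EllInf) :
    rightSlice ε (x * y) = rightSlice ε x * rightSlice ε y := by
  refine ext_entry fun i a b => ?_
  rw [rightSlice_entry, mul_entry, mul_entry, map_sum]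
  exact Finset.sum_congr rfl fun c _ => hmul _ _

theorem rightSlice_star (hstar : ∀ x, ε (star x) = star (ε x)) (x : G.Tensor G.EllInf) :
    rightSlice ε (star x) = star (rightSlice ε x) :=
  ext_entry fun i a b => hstar (x i b a)

theorem norm_rightSlice_le (hmul : ∀ x y, ε (x * y) = ε x * ε y)
    (hstar : ∀ x, ε (star x) = star (ε x)) (x : G.Tensor G.EllInf) :
    ‖rightSlice ε x‖ ≤ ‖x‖ := by
  let Φ : G.Tensor G.EllInf →⋆ₙₐ[ℂ] G.EllInf :=
    { toFun := fun x => rightSlice ε x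
      map_smul' := fun t x => (rightSlice ε).map_smul t x
      map_zero' := (rightSlice ε).map_zero
      map_add' := fun x y => (rightSlice ε).map_add x y
      map_mul' := rightSlice_mul hmul
      map_star' := rightSlice_star hstar }
  exact NonUnitalStarAlgHom.norm_apply_le Φ x

theorem IsCounit.isConditionalExpectation (h : G.IsCounit ε) :
    G.IsConditionalExpectation G.comul (G.comul.toLinearMap ∘ₗ rightSlice ε) where
  mem_range x := ⟨rightSlice ε x, rfl⟩
  apply_range y := congrArg G.comul (h.right_counit y)
  positive x hx := by
    obtain ⟨z, rfl⟩ := CStarAlgebra.nonneg_iff_eq_star_mul_self.1 hx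
    have h1 : (0 : G.EllInf) ≤ rightSlice ε (star z * z) := by
      rw [rightSlice_mul h.map_mul, rightSlice_star h.map_star]
      exact star_mul_self_nonneg _
    exact map_nonneg G.comul h1
  contractive x := (NonUnitalStarAlgHom.norm_apply_le G.comul _).trans
    (norm_rightSlice_le h.map_mul h.map_star x)
  bimodule y x z := by
    change G.comul (rightSlice ε _) = G.comul y * G.comul (rightSlice ε x) * G.comul z
    rw [rightSlice_mul h.map_mul, rightSlice_mul h.map_mul, h.right_counit, h.right_counit,
      _root_.map_mul, _root_.map_mul]

/-- A finitely supported character is equal to `1` at exactly one of the `p_k`, hence only sees the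
block `k`. -/
theorem isNormalMap_of_finitelySupported_character (hone : ε 1 = 1)
    (hmul : ∀ x y, ε (x * y) = ε x * ε y) (hstar : ∀ x, ε (star x) = star (ε x))
    (hε : FinitelySupported ε) : IsNormalMap ε := by
  classical
  obtain ⟨F, hF⟩ := hε
  obtain ⟨k, -, hk⟩ : ∃ k ∈ F, ε (proj G.dim ℂ k) ≠ 0 := by
    by_contra! hcon
    have h1 : ε (1 - ∑ k ∈ F, proj G.dim ℂ k) = 0 := hF _ fun k hk => by
      refine CStarMatrix.ext fun a b => ?_
      rw [sub_block, CStarMatrix.sub_apply, sum_entry,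
        Finset.sum_eq_single_of_mem k hk fun l _ hl => by
          rw [proj, single_block_ne hl.symm]; rfl, proj_block_self, one_block, sub_self]
      rfl
    rw [map_sub, map_sum, Finset.sum_eq_zero hcon, hone, sub_zero] at h1
    exact one_ne_zero h1
  have hk1 : ε (proj G.dim ℂ k) = 1 := by
    have := hmul (proj G.dim ℂ k) (proj G.dim ℂ k)
    rw [proj_mul_proj] at this
    exact mul_left_cancel₀ hk (by rw [← this, mul_one])
  refine isNormalMap_of_block ε (fun x hx => ?_) k fun x => by rw [hmul, hk1, one_mul]
  obtain ⟨z, rfl⟩ := CStarAlgebra.nonneg_iff_eq_star_mul_self.1 hx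
  rw [hmul, hstar]
  exact star_mul_self_nonneg _

end Counit

theorem exists_isCounit : ∃ ε : G.EllInf →L[ℂ] ℂ, G.IsCounit ε := by
  obtain ⟨ε, hε, hR, hL⟩ := G.exists_unit
  have hone := unit_map_one hR
  have hmul := unit_map_mul hR hL hε
  have hstar := unit_map_star hR hL hε
  exact ⟨ε, {
    map_one := hone
    map_mul := hmul
    map_star := hstar
    normal := isNormalMap_of_finitelySupported_character hone hmul hstar hε
    left_counit := fun x => ext_entry fun k p q =>
      (apply_leftSlice ε.toLinearMap hε (entry G.dim ℂ k p q) _).trans (hL k p q x)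
    right_counit := hR }⟩

theorem isAction_comul : G.IsAction G.comul where
  injective x y h := by
    obtain ⟨ε, hε⟩ := G.exists_isCounit
    rw [← hε.right_counit x, h, hε.right_counit]
  normal := G.comul_normal
  coaction := G.coassoc

end DiscreteQuantumGroup

end

end DQG

theorem proposition5p1 (G : DQG.DiscreteQuantumGroup.{u}) :
    G.IsAction G.comul ∧
    G.IsAmenable G.comul ∧
    (∃ ε : G.EllInf →L[ℂ] ℂ, G.IsCounit ε) ∧
    (∀ ε : G.EllInf →L[ℂ] ℂ, G.IsCounit ε →
      G.IsConditionalExpectation G.comul (G.comul.toLinearMap ∘ₗ DQG.rightSlice ε) ∧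
      G.IsEquivariant (G.comul.toLinearMap ∘ₗ DQG.rightSlice ε)) := by
  have h : ∀ ε : G.EllInf →L[ℂ] ℂ, G.IsCounit ε →
      G.IsConditionalExpectation G.comul (G.comul.toLinearMap ∘ₗ DQG.rightSlice ε) ∧
      G.IsEquivariant (G.comul.toLinearMap ∘ₗ DQG.rightSlice ε) := fun ε hε =>
    ⟨hε.isConditionalExpectation,
      DQG.DiscreteQuantumGroup.isEquivariant_comul_comp_rightSlice ε⟩
  obtain ⟨ε, hε⟩ := G.exists_isCounit
  exact ⟨G.isAction_comul, ⟨_, h ε hε⟩, ⟨ε, hε⟩, h⟩
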